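/- **Setting.** Let $m,n\in\mathbb{N}_0$. Let $\mathfrak{G}_{2n}$ be the real Grassmann algebra on anticommuting variables $\grave{x}_1,\dots,\grave{x}_{2n}$, and let $\mathcal{C}_{m,2n}$ be the real unital algebra generated by $e_1,\dots,e_m,\grave{e}_1,\dots,\grave{e}_{2n}$ with the relations $$e_je_k+e_ke_j=-2\delta_{jk},\qquad e_j\grave{e}_k+\grave{e}_ke_j=0,\qquad \grave{e}_j\grave{e}_k-\grave{e}_k\grave{e}_j=g_{jk},$$ where $g_{2j,2k}=g_{2j-1,2k-1}=0$ and $g_{2j-1,2k}=-g_{2k,2j-1}=\delta_{jk}$. For an open set $\Omega\subset\mathbb{R}\times\mathbb{R}^m$ (coordinates $x_0,x_1,\dots,x_m$) the Clifford-valued superfunctions on $\Omega$ are the elements of $C^\infty(\Omega)\otimes\mathfrak{G}_{2n}\otimes\mathcal{C}_{m,2n}$. Put $${\bf x}=\sum_{j=1}^m x_je_j+\sum_{j=1}^{2n}\grave{x}_j\grave{e}_j,\qquad |{\bf x}|^2=-{\bf x}^2,\qquad M=m-2n,$$ $$\partial_{\bf x}=2\sum_{j=1}^n\left(\grave{e}_{2j}\,\partial_{\grave{x}_{2j-1}}-\grave{e}_{2j-1}\,\partial_{\grave{x}_{2j}}\right)-\sum_{j=1}^m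 e_j\,\partial_{x_j},$$ where derivatives act from the left. Series of superfunctions are understood coefficientwise with respect to a basis of $\mathfrak{G}_{2n}\otimes\mathcal{C}_{m,2n}$. Let $J_\nu$ be the Bessel function of the first kind, and let $P_k(z)=\sum_{j=0}^k\frac{(k-j)!}{j!}z^j$ for $k\ge 0$, $P_{-1}=0$. If $h(z)=\sum_{j\ge0}\varphi_jz^{2j}$ for all $z>0$ (as for $h(z)=(z/2)^{-\nu}J_\nu(z)$), then $h(|{\bf x}|\partial_{x_0})g$ denotes the series $\sum_{j\ge 0}\varphi_j\,|{\bf x}|^{2j}\,\partial_{x_0}^{2j}g$; similarly for a polynomial $P$ in $|{\bf x}|^2\partial_{x_0}^2$. The symbol $|{\bf x}|$ itself thus occurs only in even powers. **Theorem.** Let $\Omega_1\subset\mathbb{R}$ be open, let $F_j:\Omega_1\to\mathbb{R}$ ($j\in\mathbb{N}_0$) be real analytic, and suppose that the series $$F(x_0,{\bf x})=\sum_{j=0}^\infty{\bf x}^jF_j(x_0)$$ converges in an open set $\Omega\subset\Omega_1\times\mathbb{R}^m$ containing $\Omega_1\times\{0\}$, and that its sum is monogenic there, i.e. $F$ is a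 Clifford-valued superfunction on $\Omega$ with $(\partial_{\bf x}-\partial_{x_0})F=0$. Then the following holds on $\Omega$, where all operator series that occur converge absolutely. * **i)** If $M\notin-2\mathbb{N}_0$, then $$F(x_0,{\bf x})=\Gamma\!\left(\tfrac M2\right)\left(\tfrac{|{\bf x}|\partial_{x_0}}{2}\right)^{-\frac M2}\left(\tfrac{|{\bf x}|\partial_{x_0}}{2}\,J_{\frac M2-1}\big(|{\bf x}|\partial_{x_0}\big)+\tfrac{{\bf x}\,\partial_{x_0}}{2}\,J_{\frac M2}\big(|{\bf x}|\partial_{x_0}\big)\right)F_0(x_0).$$ * **ii)** If $M=-2k$ with $k\in\mathbb{N}_0$ and $m\neq0$, then $\partial_{x_0}^{2k+1}F_0=0$ on $\Omega_1$ and $$F(x_0,{\bf x})=\frac1{k!}\left(P_k\!\Big(\tfrac{|{\bf x}|^2\partial_{x_0}^2}{4}\Big)-\tfrac{{\bf x}\,\partial_{x_0}}{2}\,P_{k-1}\!\Big(\tfrac{|{\bf x}|^2\partial_{x_0}^2}{4}\Big)\right)F_0(x_0)$$ $$\qquad+\;k!\,{\bf x}^{2k+1}\left(\tfrac{|{\bf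 x}|\partial_{x_0}}{2}\right)^{-k-1}\left(\tfrac{|{\bf x}|\partial_{x_0}}{2}\,J_k\big(|{\bf x}|\partial_{x_0}\big)+\tfrac{{\bf x}\,\partial_{x_0}}{2}\,J_{k+1}\big(|{\bf x}|\partial_{x_0}\big)\right)F_{2k+1}(x_0).$$ * **iii)** If $m=0$ (so that $M=-2n$ and $|{\bf x}|^2=-{\bf x}^2$ is purely fermionic), then $\partial_{x_0}^{2n+1}F_0=0$ on $\Omega_1$ and $$F(x_0,{\bf x})=\frac1{n!}\left(P_n\!\Big(\tfrac{-{\bf x}^2\partial_{x_0}^2}{4}\Big)-\tfrac{{\bf x}\,\partial_{x_0}}{2}\,P_{n-1}\!\Big(\tfrac{-{\bf x}^2\partial_{x_0}^2}{4}\Big)\right)F_0(x_0).$$ -/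

import Mathlib

open Filter Topology Set TensorProduct
open scoped ContDiff

noncomputable section

namespace SuperCK

/-! ## The super Clifford algebra and the Grassmann algebra -/

/-- Index set of the `2n` fermionic objects: `inl j` is the index `2j-1` and `inr j` is the
index `2j` (`j = 1, ..., n`). -/
abbrev FermIdx (n : ℕ) : Type := Fin n ⊕ Fin n

/-- The symplectic form `g` with `g_{2j-1,2k} = -g_{2k,2j-1} = δ_{jk}` and
`g_{2j,2k} = g_{2j-1,2k-1} = 0`. -/
def symplecticForm {n : ℕ} : FermIdx n → FermIdx n → ℝ
  | Sum.inl j, Sum.inr k => if j = k then 1 else 0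
  | Sum.inr k, Sum.inl j => if j = k then -1 else 0
  | Sum.inl _, Sum.inl _ => 0
  | Sum.inr _, Sum.inr _ => 0

/-- The free generators: `inl j` is the orthogonal generator `e_j`, and `inr k` is the
symplectic generator `e'_k`. -/
abbrev FreeGen (m n : ℕ) : Type := FreeAlgebra ℝ (Fin m ⊕ FermIdx n)

/-- The multiplication rules `e_j e_k + e_k e_j = -2δ_{jk}`, `e_j e'_k + e'_k e_j = 0`,
`e'_j e'_k - e'_k e'_j = g_{jk}`. -/
inductive CliffordRel (m n : ℕ) : FreeGen m n → FreeGen m n → Prop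
  | orth (j k : Fin m) :
      CliffordRel m n
        (FreeAlgebra.ι ℝ (Sum.inl j) * FreeAlgebra.ι ℝ (Sum.inl k)
          + FreeAlgebra.ι ℝ (Sum.inl k) * FreeAlgebra.ι ℝ (Sum.inl j))
        (algebraMap ℝ (FreeGen m n) (if j = k then -2 else 0))
  | mixed (j : Fin m) (k : FermIdx n) :
      CliffordRel m n
        (FreeAlgebra.ι ℝ (Sum.inl j) * FreeAlgebra.ι ℝ (Sum.inr k)
          + FreeAlgebra.ι ℝ (Sum.inr k) * FreeAlgebra.ι ℝ (Sum.inl j))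
        0
  | sympl (j k : FermIdx n) :
      CliffordRel m n
        (FreeAlgebra.ι ℝ (Sum.inr j) * FreeAlgebra.ι ℝ (Sum.inr k)
          - FreeAlgebra.ι ℝ (Sum.inr k) * FreeAlgebra.ι ℝ (Sum.inr j))
        (algebraMap ℝ (FreeGen m n) (symplecticForm j k))

/-- The super Clifford algebra `C_{m,2n}`: the real unital algebra generated by the `e_j` and the
`e'_k` subject to the rules above. -/
def SuperClifford (m n : ℕ) : Type := RingQuot (CliffordRel m n)

instance (m n : ℕ) : Ring (SuperClifford m n) := inferInstanceAs (Ring (RingQuot (CliffordRel m n)))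

instance (m n : ℕ) : Algebra ℝ (SuperClifford m n) :=
  inferInstanceAs (Algebra ℝ (RingQuot (CliffordRel m n)))

/-- A generator in the super Clifford algebra. -/
def cliffordGen (m n : ℕ) (i : Fin m ⊕ FermIdx n) : SuperClifford m n :=
  RingQuot.mkAlgHom ℝ (CliffordRel m n) (FreeAlgebra.ι ℝ i)

/-- The Grassmann algebra on the `2n` anticommuting variables. -/
abbrev Grassmann (n : ℕ) : Type := ExteriorAlgebra ℝ (FermIdx n → ℝ)

/-- The value algebra `G_{2n} ⊗ C_{m,2n}`; Grassmann variables commute with Clifford generators. -/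
abbrev SuperVal (m n : ℕ) : Type := Grassmann n ⊗[ℝ] SuperClifford m n

/-- The orthogonal Clifford generator `e_j` in `G_{2n} ⊗ C_{m,2n}`. -/
def eBos {m n : ℕ} (j : Fin m) : SuperVal m n := 1 ⊗ₜ cliffordGen m n (Sum.inl j)

/-- The symplectic Clifford generator `e'_k` in `G_{2n} ⊗ C_{m,2n}`. -/
def eFerm {m n : ℕ} (k : FermIdx n) : SuperVal m n := 1 ⊗ₜ cliffordGen m n (Sum.inr k)

/-- The anticommuting variable `x'_k` in `G_{2n} ⊗ C_{m,2n}`. -/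
def xFerm {m n : ℕ} (k : FermIdx n) : SuperVal m n :=
  ExteriorAlgebra.ι ℝ (Pi.single k (1 : ℝ)) ⊗ₜ 1

/-- The supervector variable `𝐱 = ∑ x_j e_j + ∑ x'_k e'_k`, at the point `x` of `ℝ^m`. -/
def superVector {m : ℕ} (n : ℕ) (x : Fin m → ℝ) : SuperVal m n :=
  ∑ j, x j • eBos j + ∑ k, xFerm k * eFerm k

/-- The generalized norm squared `|𝐱|² = -𝐱²`. -/
def superNormSq {m : ℕ} (n : ℕ) (x : Fin m → ℝ) : SuperVal m n := -(superVector n x) ^ 2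

/-- The superdimension `M = m - 2n`. -/
def superDim (m n : ℕ) : ℤ := (m : ℤ) - 2 * (n : ℤ)

/-! ## Clifford-valued superfunctions of `(x_0, 𝐱)` -/

/-- The underlying bosonic space `ℝ × ℝ^m` of the variables `(x_0, x_1, ..., x_m)`. -/
abbrev Pt (m : ℕ) : Type := ℝ × (Fin m → ℝ)

/-- `F` belongs to `C^∞(Ω) ⊗ G_{2n} ⊗ C_{m,2n}`: it is a finite sum of elements of
`G_{2n} ⊗ C_{m,2n}` with coefficients that are smooth on `Ω`. -/
def IsSuperfunctionOn {m n : ℕ} (F : Pt m → SuperVal m n) (Ω : Set (Pt m)) : Prop :=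
  ∃ (s : ℕ) (f : Fin s → Pt m → ℝ) (a : Fin s → SuperVal m n),
    (∀ r, ContDiffOn ℝ ∞ (f r) Ω) ∧ ∀ p ∈ Ω, F p = ∑ r, f r p • a r

/-- `w` is the derivative of `F` at `p` in the bosonic direction `v`, taken coefficientwise: every
linear coordinate of `F` is differentiable at `p` in the direction `v`, with derivative the same
coordinate of `w`. -/
def HasBosDerivAt {m n : ℕ} (F : Pt m → SuperVal m n) (w : SuperVal m n) (p v : Pt m) : Prop :=
  ∀ l : Module.Dual ℝ (SuperVal m n), HasLineDerivAt ℝ (fun q => l (F q)) (l w) p v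

open Classical in
/-- The coefficientwise derivative of `F` at `p` in the bosonic direction `v`
(`0` if it does not exist). -/
def bosDeriv {m n : ℕ} (F : Pt m → SuperVal m n) (p v : Pt m) : SuperVal m n :=
  if h : ∃ w, HasBosDerivAt F w p v then h.choose else 0

/-- The left derivative `∂_{x'_k}` with respect to an anticommuting variable, as an operator on
`G_{2n} ⊗ C_{m,2n}`. -/
def fermDeriv {m n : ℕ} (k : FermIdx n) : SuperVal m n →ₗ[ℝ] SuperVal m n :=
  LinearMap.rTensor (SuperClifford m n)
    (CliffordAlgebra.contractLeft (Q := (0 : QuadraticForm ℝ (FermIdx n → ℝ)))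
      (LinearMap.proj k))

/-- The fermionic Dirac operator `2 ∑_j (e'_{2j} ∂_{x'_{2j-1}} - e'_{2j-1} ∂_{x'_{2j}})`. -/
def fermDirac {m n : ℕ} (a : SuperVal m n) : SuperVal m n :=
  (2 : ℝ) • ∑ j : Fin n,
    (eFerm (Sum.inr j) * fermDeriv (Sum.inl j) a - eFerm (Sum.inl j) * fermDeriv (Sum.inr j) a)

/-- The bosonic Dirac operator `∑_j e_j ∂_{x_j}`. -/
def bosDirac {m n : ℕ} (F : Pt m → SuperVal m n) (p : Pt m) : SuperVal m n :=
  ∑ j : Fin m, eBos j * bosDeriv F p (0, Pi.single j 1)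

/-- The (left) super Dirac operator `∂_𝐱`: fermionic part minus bosonic part. -/
def superDirac {m n : ℕ} (F : Pt m → SuperVal m n) (p : Pt m) : SuperVal m n :=
  fermDirac (F p) - bosDirac F p

/-- The generalized Cauchy-Riemann operator `∂_𝐱 - ∂_{x_0}`. -/
def cauchyRiemann {m n : ℕ} (F : Pt m → SuperVal m n) (p : Pt m) : SuperVal m n :=
  superDirac F p - bosDeriv F p (1, 0)

/-- `F` is a (smooth, Clifford-valued) superfunction on `Ω` with `(∂_𝐱 - ∂_{x_0}) F = 0`. -/
def IsMonogenicOn {m n : ℕ} (F : Pt m → SuperVal m n) (Ω : Set (Pt m)) : Prop :=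
  IsSuperfunctionOn F Ω ∧ ∀ p ∈ Ω, cauchyRiemann F p = 0

/-! ## Series in `G_{2n} ⊗ C_{m,2n}` -/

/-- Convergence of `∑ u_j` to `S`: each linear coordinate of the partial sums converges. For terms
spanned by finitely many basis elements this is convergence of each coefficient series. -/
def SeriesConvergesTo {m n : ℕ} (u : ℕ → SuperVal m n) (S : SuperVal m n) : Prop :=
  ∀ l : Module.Dual ℝ (SuperVal m n),
    Tendsto (fun N => l (∑ j ∈ Finset.range N, u j)) atTop (𝓝 (l S))

/-- Absolute convergence of `∑ u_j` to `S`, in each linear coordinate. -/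
def SeriesConvergesAbsTo {m n : ℕ} (u : ℕ → SuperVal m n) (S : SuperVal m n) : Prop :=
  ∀ l : Module.Dual ℝ (SuperVal m n), HasSum (fun j => l (u j)) (l S)

/-! ## Bessel functions and Appell polynomials -/

/-- The Bessel function of the first kind `J_ν`, for positive real arguments. -/
def besselJ (ν z : ℝ) : ℝ :=
  ∑' j : ℕ, (-1) ^ j / (j.factorial * Real.Gamma (ν + j + 1)) * (z / 2) ^ (2 * (j : ℝ) + ν)

/-- The Appell polynomials `P_k(z) = ∑_{j=0}^k (k-j)!/j! z^j`, with `P_k = 0` for `k < 0`. -/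
def appellP : ℤ → Polynomial ℝ
  | Int.ofNat k => ∑ j ∈ Finset.range (k + 1),
      Polynomial.monomial j (((k - j).factorial : ℝ) / (j.factorial : ℝ))
  | Int.negSucc _ => 0

/-- `A` is the value at `t` of the formal operator expression `h(√N ∂) g`, where `h` is a function
of `z > 0` that is given by a power series `h(z) = ∑_j φ_j z^{2j}` in even powers of `z`: the value
is the (absolutely convergent) sum `∑_j φ_j N^j g^{(2j)}(t)`. The coefficients `φ_j` are determined
by `h`. -/
def HasOpValue {m n : ℕ} (h : ℝ → ℝ) (N : SuperVal m n) (g : ℝ → ℝ) (t : ℝ)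
    (A : SuperVal m n) : Prop :=
  ∃ φ : ℕ → ℝ, (∀ z : ℝ, 0 < z → HasSum (fun j => φ j * z ^ (2 * j)) (h z)) ∧
    SeriesConvergesAbsTo (fun j => (φ j * iteratedDeriv (2 * j) g t) • N ^ j) A

/-- The value at `t` of `P(N ∂²) g = ∑_j P_j N^j g^{(2j)}`, for a polynomial `P`. -/
def polyOp {m n : ℕ} (P : Polynomial ℝ) (N : SuperVal m n) (g : ℝ → ℝ) (t : ℝ) : SuperVal m n :=
  P.sum fun j a => (a * iteratedDeriv (2 * j) g t) • N ^ j

/-! ## Facts that show that the definitions mean what they should -/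

theorem fermDeriv_xFerm_mul {m n : ℕ} (j k : FermIdx n) (a : SuperVal m n) :
    fermDeriv j (xFerm k * a) + xFerm k * fermDeriv j a = if j = k then a else 0 := by
  induction a using TensorProduct.induction_on with
  | zero => simp
  | add a b ha hb =>
    have : fermDeriv j (xFerm k * (a + b)) + xFerm k * fermDeriv j (a + b)
        = (fermDeriv j (xFerm k * a) + xFerm k * fermDeriv j a)
          + (fermDeriv j (xFerm k * b) + xFerm k * fermDeriv j b) := by
      simp only [mul_add, map_add]; abel
    rw [this, ha, hb]; split_ifs <;> simp
  | tmul a c =>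
    have h := CliffordAlgebra.contractLeft_ι_mul (Q := (0 : QuadraticForm ℝ (FermIdx n → ℝ)))
      (d := LinearMap.proj j) (Pi.single k (1 : ℝ)) a
    simp only [fermDeriv, xFerm, Algebra.TensorProduct.tmul_mul_tmul, one_mul,
      LinearMap.rTensor_tmul]
    erw [h]
    rw [TensorProduct.sub_tmul]
    erw [sub_add_cancel]
    by_cases hjk : j = k
    · subst hjk; simp
    · simp [hjk]

theorem hasBosDerivAt_unique {m n : ℕ} {F : Pt m → SuperVal m n} {w w' : SuperVal m n}
    {p v : Pt m} (h : HasBosDerivAt F w p v) (h' : HasBosDerivAt F w' p v) : w = w' := by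
  rw [← sub_eq_zero, ← Module.forall_dual_apply_eq_zero_iff ℝ]
  intro l
  rw [map_sub, (h l).unique (h' l), sub_self]

theorem bosDeriv_eq {m n : ℕ} {F : Pt m → SuperVal m n} {Ω : Set (Pt m)} (hΩ : IsOpen Ω)
    {s : ℕ} {f : Fin s → Pt m → ℝ} {a : Fin s → SuperVal m n}
    (hf : ∀ r, ContDiffOn ℝ ∞ (f r) Ω) (hF : ∀ p ∈ Ω, F p = ∑ r, f r p • a r)
    {p : Pt m} (hp : p ∈ Ω) (v : Pt m) :
    bosDeriv F p v = ∑ r, (fderiv ℝ (f r) p v) • a r := by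
  have key : HasBosDerivAt F (∑ r, (fderiv ℝ (f r) p v) • a r) p v := by
    intro l
    have hd : ∀ r, HasFDerivAt (f r) (fderiv ℝ (f r) p) p := fun r =>
      (((hf r).contDiffAt (hΩ.mem_nhds hp)).differentiableAt (by simp)).hasFDerivAt
    have h1 : HasFDerivAt (fun q => ∑ r, f r q * l (a r))
        (∑ r, (l (a r)) • fderiv ℝ (f r) p) p :=
      HasFDerivAt.fun_sum fun r _ => (hd r).mul_const (l (a r))
    have h2 : HasFDerivAt (fun q => l (F q)) (∑ r, (l (a r)) • fderiv ℝ (f r) p) p := by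
      refine h1.congr_of_eventuallyEq ?_
      filter_upwards [hΩ.mem_nhds hp] with q hq
      simp [hF q hq, map_sum]
    have h3 := h2.hasLineDerivAt v
    have h4 : l (∑ r, (fderiv ℝ (f r) p v) • a r) = (∑ r, (l (a r)) • fderiv ℝ (f r) p) v := by
      simp [map_sum, mul_comm]
    rw [h4]
    exact h3
  have hex : ∃ w, HasBosDerivAt F w p v := ⟨_, key⟩
  rw [bosDeriv, dif_pos hex]
  exact hasBosDerivAt_unique hex.choose_spec key

theorem seriesConvergesTo_iff {m n s : ℕ} {a : Fin s → SuperVal m n} (ha : LinearIndependent ℝ a)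
    (c : ℕ → Fin s → ℝ) (b : Fin s → ℝ) :
    SeriesConvergesTo (fun j => ∑ r, c j r • a r) (∑ r, b r • a r) ↔
      ∀ r, Tendsto (fun N => ∑ j ∈ Finset.range N, c j r) atTop (𝓝 (b r)) := by
  constructor
  · intro h r
    obtain ⟨l, hl⟩ := LinearMap.exists_extend (((Finsupp.lapply r : (Fin s →₀ ℝ) →ₗ[ℝ] ℝ)) ∘ₗ
      ha.repr)
    have hl' : ∀ r', l (a r') = if r' = r then 1 else 0 := by
      intro r'
      have h1 := LinearMap.congr_fun hl ⟨a r', Submodule.subset_span ⟨r', rfl⟩⟩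
      have h2 := ha.repr_eq_single r' ⟨a r', Submodule.subset_span ⟨r', rfl⟩⟩ rfl
      simpa [h2, Finsupp.single_apply] using h1
    simpa [map_sum, hl'] using h l
  · intro h l
    have h1 : Tendsto (fun N => ∑ r, (∑ j ∈ Finset.range N, c j r) * l (a r)) atTop
        (𝓝 (∑ r, b r * l (a r))) :=
      tendsto_finsetSum _ fun r _ => (h r).mul_const _
    convert h1 using 2
    · simp only [map_sum, map_smul, smul_eq_mul, Finset.sum_mul]
      rw [Finset.sum_comm]
    · simp [map_sum]

theorem hasSum_besselJ (ν : ℝ) {z : ℝ} (hz : 0 < z) :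
    HasSum (fun j : ℕ => (-1) ^ j / (4 ^ j * j.factorial * Real.Gamma (ν + j + 1)) * z ^ (2 * j))
      ((z / 2) ^ (-ν) * besselJ ν z) := by
  have hsum : Summable (fun j : ℕ =>
      (-1) ^ j / (4 ^ j * j.factorial * Real.Gamma (ν + j + 1)) * z ^ (2 * j)) := by
    obtain ⟨N, hN⟩ := exists_nat_ge (max (z ^ 2) (-ν))
    refine summable_of_ratio_norm_eventually_le (r := 1 / 2) (by norm_num) ?_
    filter_upwards [eventually_ge_atTop N] with j hj
    have hj' : (N : ℝ) ≤ j := by exact_mod_cast hj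
    have h1 : z ^ 2 ≤ (j : ℝ) := (le_max_left _ _).trans (hN.trans hj')
    have h2 : -ν ≤ (j : ℝ) := (le_max_right _ _).trans (hN.trans hj')
    have h3 : (1 : ℝ) ≤ ν + j + 1 := by linarith
    have hG : Real.Gamma (ν + (j + 1 : ℕ) + 1) = (ν + j + 1) * Real.Gamma (ν + j + 1) := by
      rw [← Real.Gamma_add_one (by linarith)]; push_cast; ring_nf
    have hGpos : 0 < Real.Gamma (ν + j + 1) := Real.Gamma_pos_of_pos (by linarith)
    have hj1 : (0 : ℝ) < (j : ℝ) + 1 := by positivity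
    have hrat : (-1 : ℝ) ^ (j + 1) /
          (4 ^ (j + 1) * ((j + 1).factorial : ℝ) * Real.Gamma (ν + (j + 1 : ℕ) + 1))
          * z ^ (2 * (j + 1))
        = (-(z ^ 2 / (4 * (j + 1) * (ν + j + 1)))) *
          ((-1) ^ j / (4 ^ j * (j.factorial : ℝ) * Real.Gamma (ν + j + 1)) * z ^ (2 * j)) := by
      have hfac : (j.factorial : ℝ) ≠ 0 := by positivity
      have hne : ν + j + 1 ≠ 0 := by linarith
      rw [hG, Nat.factorial_succ]
      push_cast
      field_simp
      ring
    rw [hrat, norm_mul]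
    refine mul_le_mul_of_nonneg_right ?_ (norm_nonneg _)
    rw [norm_neg, Real.norm_of_nonneg (by positivity), div_le_div_iff₀ (by positivity) (by norm_num)]
    nlinarith [sq_nonneg z, mul_le_mul_of_nonneg_left h3 hj1.le]
  have hz2 : 0 < z / 2 := by positivity
  have hval : (z / 2) ^ (-ν) * besselJ ν z = ∑' j : ℕ,
      (-1) ^ j / (4 ^ j * j.factorial * Real.Gamma (ν + j + 1)) * z ^ (2 * j) := by
    rw [besselJ, ← tsum_mul_left]
    refine tsum_congr fun j => ?_
    have hpow : (z / 2) ^ (-ν) * (z / 2) ^ (2 * (j : ℝ) + ν) = z ^ (2 * j) / 4 ^ j := by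
      rw [← Real.rpow_add hz2]
      have : -ν + (2 * (j : ℝ) + ν) = ((2 * j : ℕ) : ℝ) := by push_cast; ring
      rw [this, Real.rpow_natCast, div_pow, pow_mul 2 2 j]
      norm_num
    calc _ = (-1) ^ j / (j.factorial * Real.Gamma (ν + j + 1)) *
          ((z / 2) ^ (-ν) * (z / 2) ^ (2 * (j : ℝ) + ν)) := by ring
      _ = _ := by rw [hpow, div_mul_div_comm, div_mul_eq_mul_div]; congr 1; ring
  rw [hval]
  exact hsum.hasSum

end SuperCK

end

/-!
The proof reduces the theorem to a first-order recursion for the coefficients.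

Write `Θ` for the fermionic part of the supervector variable `𝐱`, `ρ` for the squared Euclidean
norm of its bosonic part, and `q = Θ²`. Then `𝐱² = -ρ + q`, where `q` is nilpotent
(`superVector_sq`, `fermSq_pow_succ`). The Dirac operator acts by `∂_𝐱 𝐱^j = c_j 𝐱^{j-1}` with
`c_{2s} = 2s` and `c_{2s+1} = M + 2s` (`diracCoeff`), so that monogenicity of `∑ 𝐱^j f_j` should
mean `f_j' = c_{j+1} f_{j+1}`.

For `m ≠ 0` (`hasDerivAt_coeff`), set the anticommuting variables to zero after the Dirac operator
has been applied (`body`). The body of `∑ f_j 𝐱^j` has the form `E(ρ) + O(ρ) y`, with `y` the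
bosonic vector and `E`, `O` power series, whose coefficients can be read off because the super
Clifford algebra is nontrivial (`spinorGen` gives a representation). On a coordinate axis the Dirac operator in the bosonic variables involves only `E`, `O`, `E'` and `O'`, and the
fermionic one contributes `-2n O`. The terms `∂_{x_0} E` and `∂_{x_0} O` cannot be differentiated
termwise, since nothing is known about uniformity in `x_0`. But the sum is smooth, so that
`∂_{x_0}` commutes with the Taylor coefficients along the axis
(`hasDerivAt_coeff_of_contDiffOn`), and comparing these gives the recursion.

For `m = 0` (`hasDerivAt_coeff_fin_zero`), the series is a finite sum, because `Θ^{2n+1} = 0`, and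
the powers `Θ^j` with `j ≤ 2n` are linearly independent: the fermionic Dirac operator maps each of
them to a nonzero multiple of the preceding one.

The recursion turns the `i`-th derivative of `f_a` into `c_{a+1} ⋯ c_{a+i} f_{a+i}`
(`iteratedDeriv_coeff`). The products are quotients of Gamma functions, which match the
coefficients of the Bessel functions and of the Appell polynomials. If `M = -2k`, then
`c_{2k+1} = 0`, which yields `f_0^{(2k+1)} = 0` and leaves `f_{2k+1}` undetermined by `f_0`.
Absolute convergence at a point follows from convergence at a point with larger `ρ`, as `q` is
nilpotent (`exists_hasSum_smul_pow_of_nilpotent`).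
-/

namespace SuperCK

/-! ### Nontriviality of the super Clifford algebra -/

/-- The Clifford algebra of the negative definite form on `ℝ^m`. -/
abbrev NegClifford (m : ℕ) : Type :=
  CliffordAlgebra (QuadraticMap.weightedSumSquares ℝ (fun _ : Fin m => (-1 : ℝ)))

/-- The Weyl algebra action on polynomials in `n` variables: the odd generators `inl j` act as
`∂/∂X_j`, the even generators `inr j` as multiplication by `X_j`. -/
noncomputable def weylOp (n : ℕ) : FermIdx n → Module.End ℝ (MvPolynomial (Fin n) ℝ)
  | Sum.inl j => (MvPolynomial.pderiv j).toLinearMap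
  | Sum.inr j => LinearMap.mulLeft ℝ (MvPolynomial.X j)

theorem weylOp_comm (n : ℕ) (j k : FermIdx n) :
    weylOp n j * weylOp n k - weylOp n k * weylOp n j
      = algebraMap ℝ _ (symplecticForm j k) := by
  rcases j with j | j <;> rcases k with k | k <;>
    refine LinearMap.ext fun p => ?_ <;>
    simp only [weylOp, symplecticForm, LinearMap.sub_apply,
      Module.End.mul_apply, LinearMap.mulLeft_apply, Derivation.coeFn_coe,
      Module.algebraMap_end_apply, map_zero, LinearMap.zero_apply]
  · have h : ⁅MvPolynomial.pderiv (R := ℝ) j, MvPolynomial.pderiv k⁆ = 0 :=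
      MvPolynomial.derivation_ext fun i => by
        classical
        rw [Derivation.commutator_apply, MvPolynomial.pderiv_X, MvPolynomial.pderiv_X]
        simp [Pi.single_apply, apply_ite]
    exact (Derivation.commutator_apply p).symm.trans (DFunLike.congr_fun h p)
  · rw [MvPolynomial.pderiv_mul]
    by_cases h : j = k
    · subst h; simp
    · rw [MvPolynomial.pderiv_X_of_ne (Ne.symm h)]; simp [h]
  · rw [MvPolynomial.pderiv_mul]
    by_cases h : k = j
    · subst h; simp
    · rw [MvPolynomial.pderiv_X_of_ne (Ne.symm h)]; simp [h]
  · ring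

/-- Images of the free generators under the representation of the super Clifford algebra on
spinors: the `e_j` act by left multiplication on `NegClifford m`, and the `e'_k` by the grading
involution of `NegClifford m` tensored with the Weyl operators. The involution makes the
two families anticommute. -/
noncomputable def spinorGen (m n : ℕ) : Fin m ⊕ FermIdx n →
    Module.End ℝ (NegClifford m) ⊗[ℝ] Module.End ℝ (MvPolynomial (Fin n) ℝ)
  | Sum.inl j => LinearMap.mulLeft ℝ (CliffordAlgebra.ι _ (Pi.single j 1)) ⊗ₜ 1
  | Sum.inr k => CliffordAlgebra.involute.toLinearMap ⊗ₜ weylOp n k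

theorem spinorGen_rel (m n : ℕ) ⦃a b : FreeGen m n⦄ (h : CliffordRel m n a b) :
    FreeAlgebra.lift ℝ (spinorGen m n) a = FreeAlgebra.lift ℝ (spinorGen m n) b := by
  cases h with
  | orth j k =>
    simp only [map_add, map_mul, FreeAlgebra.lift_ι_apply, AlgHom.commutes, spinorGen,
      Algebra.TensorProduct.tmul_mul_tmul, one_mul]
    rw [← TensorProduct.add_tmul, Algebra.TensorProduct.algebraMap_apply]
    congr 1
    refine LinearMap.ext fun x => ?_
    have h := CliffordAlgebra.ι_mul_ι_add_swap
      (Q := QuadraticMap.weightedSumSquares ℝ (fun _ : Fin m => (-1 : ℝ)))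
      (Pi.single j 1) (Pi.single k 1)
    simp only [LinearMap.add_apply, Module.End.mul_apply, LinearMap.mulLeft_apply, ← mul_assoc,
      ← add_mul, h, Module.algebraMap_end_apply]
    rw [← Algebra.smul_def]
    congr 1
    simp only [QuadraticMap.polar, QuadraticMap.weightedSumSquares_apply, Pi.add_apply,
      smul_eq_mul, neg_one_mul]
    rw [← Finset.sum_sub_distrib, ← Finset.sum_sub_distrib]
    by_cases hjk : j = k
    · subst hjk
      rw [Finset.sum_eq_single j] <;> simp +contextual
      norm_num
    · rw [if_neg hjk]
      refine Finset.sum_eq_zero fun i _ => ?_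
      by_cases hj : i = j
      · subst hj; simp [hjk]
      · simp [Pi.single_apply, hj]
  | mixed j k =>
    simp only [map_add, map_mul, FreeAlgebra.lift_ι_apply, spinorGen, map_zero,
      Algebra.TensorProduct.tmul_mul_tmul, one_mul, mul_one]
    rw [← TensorProduct.add_tmul]
    refine (congrArg (· ⊗ₜ[ℝ] weylOp n k) (?_ : _ = (0 : Module.End ℝ (NegClifford m)))).trans
      (TensorProduct.zero_tmul _ _)
    refine LinearMap.ext fun x => ?_
    simp [Module.End.mul_apply]
  | sympl j k =>
    simp only [map_sub, map_mul, FreeAlgebra.lift_ι_apply, AlgHom.commutes, spinorGen,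
      Algebra.TensorProduct.tmul_mul_tmul]
    rw [← TensorProduct.tmul_sub, weylOp_comm, Algebra.TensorProduct.algebraMap_apply,
      Algebra.algebraMap_eq_smul_one, TensorProduct.tmul_smul, Algebra.algebraMap_eq_smul_one,
      TensorProduct.smul_tmul']
    congr 2
    refine LinearMap.ext fun x => ?_
    simp [Module.End.mul_apply]

/-- The super Clifford algebra has a nonzero module. -/
instance (m n : ℕ) : Nontrivial (SuperClifford m n) := by
  let T := Module.End ℝ (NegClifford m) ⊗[ℝ] Module.End ℝ (MvPolynomial (Fin n) ℝ)
  let φ : RingQuot (CliffordRel m n) →ₐ[ℝ] T :=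
    RingQuot.liftAlgHom ℝ ⟨FreeAlgebra.lift ℝ (spinorGen m n), spinorGen_rel m n⟩
  have hT : Nontrivial T :=
    (Algebra.TensorProduct.includeLeft_injective (R := ℝ) (S := ℝ)
      (A := Module.End ℝ (NegClifford m)) (B := Module.End ℝ (MvPolynomial (Fin n) ℝ))
      (algebraMap ℝ _).injective).nontrivial
  exact φ.toRingHom.domain_nontrivial

/-! ### Generators and the supervector variable -/

theorem cliffordGen_orth {m n : ℕ} (j k : Fin m) :
    cliffordGen m n (Sum.inl j) * cliffordGen m n (Sum.inl k)
      + cliffordGen m n (Sum.inl k) * cliffordGen m n (Sum.inl j)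
      = algebraMap ℝ _ (if j = k then -2 else 0) := by
  have h := RingQuot.mkAlgHom_rel ℝ (CliffordRel.orth (n := n) j k)
  rw [map_add, map_mul, map_mul, AlgHom.commutes] at h
  exact h

theorem cliffordGen_mixed {m n : ℕ} (j : Fin m) (k : FermIdx n) :
    cliffordGen m n (Sum.inl j) * cliffordGen m n (Sum.inr k)
      = -(cliffordGen m n (Sum.inr k) * cliffordGen m n (Sum.inl j)) := by
  have h := RingQuot.mkAlgHom_rel ℝ (CliffordRel.mixed j k)
  rw [map_add, map_mul, map_mul, map_zero] at h
  exact eq_neg_of_add_eq_zero_left h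

theorem cliffordGen_sympl {m n : ℕ} (j k : FermIdx n) :
    cliffordGen m n (Sum.inr j) * cliffordGen m n (Sum.inr k)
      = cliffordGen m n (Sum.inr k) * cliffordGen m n (Sum.inr j)
        + algebraMap ℝ _ (symplecticForm j k) := by
  have h := RingQuot.mkAlgHom_rel ℝ (CliffordRel.sympl (m := m) j k)
  rw [map_sub, map_mul, map_mul, AlgHom.commutes] at h
  exact (sub_eq_iff_eq_add'.1 h)

/-- The homomorphism that sets all anticommuting variables to zero. -/
noncomputable def body (m n : ℕ) : SuperVal m n →ₐ[ℝ] SuperClifford m n :=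
  Algebra.TensorProduct.lift ((Algebra.ofId ℝ _).comp ExteriorAlgebra.algebraMapInv)
    (AlgHom.id ℝ _) fun a b => by
      rw [AlgHom.comp_apply, Algebra.ofId_apply]
      exact Algebra.commute_algebraMap_left _ _

instance (m n : ℕ) : Nontrivial (SuperVal m n) := (body m n).toRingHom.domain_nontrivial

theorem body_eBos {m n : ℕ} (j : Fin m) :
    body m n (eBos j) = cliffordGen m n (Sum.inl j) := by
  rw [body, eBos, Algebra.TensorProduct.lift_tmul, map_one, one_mul]
  rfl

theorem body_eFerm {m n : ℕ} (k : FermIdx n) :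
    body m n (eFerm k) = cliffordGen m n (Sum.inr k) := by
  rw [body, eFerm, Algebra.TensorProduct.lift_tmul, map_one, one_mul]
  rfl

theorem body_xFerm {m n : ℕ} (k : FermIdx n) : body m n (xFerm k) = 0 := by
  simp [body, xFerm, ExteriorAlgebra.algebraMapInv]

theorem xFerm_mul_swap {m n : ℕ} (j k : FermIdx n) :
    (xFerm j * xFerm k : SuperVal m n) = -(xFerm k * xFerm j) := by
  rw [xFerm, xFerm, Algebra.TensorProduct.tmul_mul_tmul, Algebra.TensorProduct.tmul_mul_tmul,
    ← TensorProduct.neg_tmul]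
  congr 1
  exact eq_neg_of_add_eq_zero_left (ExteriorAlgebra.ι_add_mul_swap _ _)

theorem xFerm_sq {m n : ℕ} (j : FermIdx n) : (xFerm j * xFerm j : SuperVal m n) = 0 := by
  rw [xFerm, Algebra.TensorProduct.tmul_mul_tmul, ExteriorAlgebra.ι_sq_zero,
    TensorProduct.zero_tmul]

theorem eFerm_mul_xFerm {m n : ℕ} (j k : FermIdx n) :
    (eFerm j * xFerm k : SuperVal m n) = xFerm k * eFerm j := by
  simp [xFerm, eFerm]

theorem eBos_mul_xFerm {m n : ℕ} (j : Fin m) (k : FermIdx n) :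
    (eBos j * xFerm k : SuperVal m n) = xFerm k * eBos j := by
  simp [xFerm, eBos]

theorem eBos_mul_eFerm {m n : ℕ} (j : Fin m) (k : FermIdx n) :
    (eBos j * eFerm k : SuperVal m n) = -(eFerm k * eBos j) := by
  simp [eFerm, eBos, cliffordGen_mixed, TensorProduct.tmul_neg]

theorem eBos_mul_swap {m n : ℕ} (j k : Fin m) :
    (eBos j * eBos k + eBos k * eBos j : SuperVal m n)
      = algebraMap ℝ _ (if j = k then -2 else 0) := by
  rw [eBos, eBos, Algebra.TensorProduct.tmul_mul_tmul, Algebra.TensorProduct.tmul_mul_tmul,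
    ← TensorProduct.tmul_add, cliffordGen_orth, Algebra.algebraMap_eq_smul_one,
    TensorProduct.tmul_smul, Algebra.algebraMap_eq_smul_one, Algebra.TensorProduct.one_def, one_mul]

theorem eFerm_mul_swap {m n : ℕ} (j k : FermIdx n) :
    (eFerm j * eFerm k : SuperVal m n) = eFerm k * eFerm j + symplecticForm j k • 1 := by
  rw [eFerm, eFerm, Algebra.TensorProduct.tmul_mul_tmul, cliffordGen_sympl,
    TensorProduct.tmul_add, Algebra.algebraMap_eq_smul_one,
    TensorProduct.tmul_smul, Algebra.TensorProduct.tmul_mul_tmul, Algebra.TensorProduct.one_def,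
    one_mul]

/-- The fermionic part `Θ = ∑ x'_k e'_k` of the supervector variable. -/
def fermVector (m n : ℕ) : SuperVal m n := ∑ k, xFerm k * eFerm k

/-- The bosonic part `∑ x_j e_j` of the supervector variable. -/
def bosVector {m : ℕ} (n : ℕ) (x : Fin m → ℝ) : SuperVal m n := ∑ j, x j • eBos j

/-- The square `∑_j x'_{2j-1} x'_{2j}` of the fermionic part of the supervector variable. -/
def fermSq (m n : ℕ) : SuperVal m n := ∑ j : Fin n, xFerm (Sum.inl j) * xFerm (Sum.inr j)

theorem superVector_eq {m : ℕ} (n : ℕ) (x : Fin m → ℝ) :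
    superVector n x = bosVector n x + fermVector m n := rfl

theorem bosVector_sq {m : ℕ} (n : ℕ) (x : Fin m → ℝ) :
    bosVector n x * bosVector n x = -(∑ j, x j ^ 2) • (1 : SuperVal m n) := by
  have h : bosVector n x * bosVector n x
      = ∑ j, ∑ k, (x j * x k) • (eBos j * eBos k : SuperVal m n) := by
    simp only [bosVector, Finset.sum_mul, Finset.mul_sum, smul_mul_smul_comm]
    exact Finset.sum_comm
  have h' : bosVector n x * bosVector n x
      = ∑ j, ∑ k, (x j * x k) • (eBos k * eBos j : SuperVal m n) := by
    rw [h, Finset.sum_comm]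
    simp only [mul_comm]
  -- symmetrizing the double sum brings in the anticommutators
  have h2 : (2 : ℝ) • (bosVector n x * bosVector n x)
      = (2 : ℝ) • (-(∑ j, x j ^ 2) • (1 : SuperVal m n)) := by
    rw [two_smul]
    nth_rewrite 1 [h]
    rw [h']
    simp only [← Finset.sum_add_distrib, ← smul_add, eBos_mul_swap,
      Algebra.algebraMap_eq_smul_one, smul_smul, ite_smul, zero_smul, smul_ite, smul_zero,
      Finset.sum_ite_eq, Finset.mem_univ, if_true]
    rw [← Finset.sum_smul, ← Finset.sum_neg_distrib, Finset.mul_sum]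
    congr 1
    exact Finset.sum_congr rfl fun j _ => by ring
  exact smul_right_injective _ two_ne_zero h2

theorem fermVector_sq (m n : ℕ) : fermVector m n * fermVector m n = fermSq m n := by
  have h : fermVector m n * fermVector m n
      = ∑ j, ∑ k, (xFerm j * xFerm k) * (eFerm j * eFerm k) := by
    simp only [fermVector, Finset.sum_mul, Finset.mul_sum]
    rw [Finset.sum_comm]
    refine Finset.sum_congr rfl fun j _ => Finset.sum_congr rfl fun k _ => ?_
    rw [mul_assoc, ← mul_assoc (eFerm j), eFerm_mul_xFerm]
    simp only [mul_assoc]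
  -- swapping the summation indices costs a sign from the `x'_k` and a commutator of the `e'_k`
  have h' : fermVector m n * fermVector m n
      = -(fermVector m n * fermVector m n)
        + ∑ j, ∑ k, symplecticForm j k • (xFerm j * xFerm k : SuperVal m n) := by
    nth_rewrite 2 [h]
    rw [h]
    nth_rewrite 2 [Finset.sum_comm]
    simp only [← Finset.sum_neg_distrib, ← Finset.sum_add_distrib]
    refine Finset.sum_congr rfl fun j _ => Finset.sum_congr rfl fun k _ => ?_
    rw [eFerm_mul_swap, xFerm_mul_swap k j, mul_add, neg_mul, neg_neg, mul_smul_comm, mul_one]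
  have h3 : ∑ j, ∑ k, symplecticForm j k • (xFerm j * xFerm k : SuperVal m n)
      = (2 : ℝ) • fermSq m n := by
    simp only [Fintype.sum_sum_type, symplecticForm, zero_smul, Finset.sum_const_zero, zero_add,
      add_zero, ite_smul, one_smul, fermSq, two_smul]
    congr 1
    · simp
    · refine Finset.sum_congr rfl fun j _ => ?_
      simp [xFerm_mul_swap (Sum.inr j)]
  refine smul_right_injective _ (two_ne_zero (α := ℝ)) ?_
  change (2 : ℝ) • _ = (2 : ℝ) • _
  rw [← h3, two_smul]
  nth_rewrite 1 [h']
  abel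

theorem bosVector_mul_fermVector {m : ℕ} (n : ℕ) (x : Fin m → ℝ) :
    bosVector n x * fermVector m n = -(fermVector m n * bosVector n x) := by
  simp only [bosVector, fermVector, Finset.sum_mul, Finset.mul_sum]
  rw [Finset.sum_comm, ← Finset.sum_neg_distrib]
  refine Finset.sum_congr rfl fun k _ => ?_
  rw [← Finset.sum_neg_distrib]
  refine Finset.sum_congr rfl fun j _ => ?_
  rw [smul_mul_assoc, mul_smul_comm, ← smul_neg, ← mul_assoc, eBos_mul_xFerm, mul_assoc,
    eBos_mul_eFerm, mul_neg, mul_assoc]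

theorem superVector_sq {m : ℕ} (n : ℕ) (x : Fin m → ℝ) :
    superVector n x ^ 2 = -(∑ j, x j ^ 2) • (1 : SuperVal m n) + fermSq m n := by
  rw [superVector_eq, sq, add_mul, mul_add, mul_add, bosVector_sq, bosVector_mul_fermVector,
    fermVector_sq]
  abel

theorem superNormSq_eq {m : ℕ} (n : ℕ) (x : Fin m → ℝ) :
    superNormSq n x = (∑ j, x j ^ 2) • (1 : SuperVal m n) + -fermSq m n := by
  rw [superNormSq, superVector_sq, neg_add, neg_smul, neg_neg]

theorem superVector_pow_two_mul {m : ℕ} (n : ℕ) (x : Fin m → ℝ) (j : ℕ) :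
    superVector n x ^ (2 * j) = (-1 : ℝ) ^ j • superNormSq n x ^ j := by
  rw [pow_mul, superNormSq, ← smul_pow, neg_one_smul, neg_neg]

/-! ### Nilpotency of the fermionic part -/

theorem commute_xFerm_mul_xFerm {m n : ℕ} (i j k : FermIdx n) :
    Commute (xFerm i : SuperVal m n) (xFerm j * xFerm k) := by
  rw [Commute, SemiconjBy, ← mul_assoc, xFerm_mul_swap i j, neg_mul, mul_assoc,
    xFerm_mul_swap i k, mul_neg, neg_neg, mul_assoc]

/-- Partial sums of `fermSq` over `s` have nilpotency order at most `|s| + 1`, and their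
`|s|`-th power, a multiple of the product of all `x'_{2j-1} x'_{2j}` with `j ∈ s`, is
annihilated by every anticommuting variable with index in `s`. -/
theorem fermSq_partial_pow {m n : ℕ} (s : Finset (Fin n)) :
    (∑ j ∈ s, xFerm (Sum.inl j) * xFerm (Sum.inr j) : SuperVal m n) ^ (s.card + 1) = 0 ∧
    ∀ j ∈ s, xFerm (Sum.inl j) *
        (∑ j ∈ s, xFerm (Sum.inl j) * xFerm (Sum.inr j) : SuperVal m n) ^ s.card = 0 ∧
      xFerm (Sum.inr j) *
        (∑ j ∈ s, xFerm (Sum.inl j) * xFerm (Sum.inr j) : SuperVal m n) ^ s.card = 0 := by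
  classical
  induction s using Finset.induction_on with
  | empty => simp
  | insert i s hi ih =>
    obtain ⟨ih0, ih1⟩ := ih
    rw [Finset.sum_insert hi, Finset.card_insert_of_notMem hi]
    set Q : SuperVal m n := ∑ j ∈ s, xFerm (Sum.inl j) * xFerm (Sum.inr j)
    set p : SuperVal m n := xFerm (Sum.inl i) * xFerm (Sum.inr i) with hp
    have hlp : xFerm (Sum.inl i) * p = 0 := by rw [hp, ← mul_assoc, xFerm_sq, zero_mul]
    have hrp : xFerm (Sum.inr i) * p = 0 := by
      rw [hp, xFerm_mul_swap, mul_neg, ← mul_assoc, xFerm_sq, zero_mul, neg_zero]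
    have hp2 : p ^ 2 = 0 := by
      rw [sq]; nth_rewrite 1 [hp]; rw [mul_assoc, hrp, mul_zero]
    have hcQ : ∀ k, Commute (xFerm k) Q := fun k =>
      Commute.sum_right _ _ _ fun j _ => commute_xFerm_mul_xFerm _ _ _
    have hcp : Commute p Q := (hcQ _).mul_left (hcQ _)
    clear_value p
    have hpow : ∀ N, (p + Q) ^ (N + 1) = Q ^ (N + 1) + (N + 1) • (Q ^ N * p) := by
      intro N
      induction N with
      | zero => simp [add_comm]
      | succ N ih =>
        rw [pow_succ, ih, add_mul, mul_add, mul_add, smul_mul_assoc, mul_assoc, ← sq, hp2,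
          mul_zero, smul_zero, zero_add, smul_mul_assoc, mul_assoc, hcp.eq, ← mul_assoc,
          ← pow_succ, ← pow_succ, add_comm (Q ^ (N + 1) * p), add_assoc, succ_nsmul _ (N + 1),
          add_comm (Q ^ (N + 1) * p)]
    have hk : (p + Q) ^ (s.card + 1) = (s.card + 1) • (Q ^ s.card * p) := by
      rw [hpow, ih0, zero_add]
    refine ⟨?_, ?_⟩
    · rw [hpow, pow_succ Q (s.card + 1), ih0, zero_mul, zero_mul, smul_zero, add_zero]
    · intro j hj
      rw [hk, mul_smul_comm, mul_smul_comm, ← mul_assoc, ← mul_assoc]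
      rcases Finset.mem_insert.1 hj with rfl | hj
      · rw [((hcQ _).pow_right _).eq, mul_assoc, hlp, ((hcQ _).pow_right _).eq, mul_assoc, hrp]
        simp
      · rw [(ih1 j hj).1, (ih1 j hj).2]
        simp

theorem fermSq_pow_succ (m n : ℕ) : fermSq m n ^ (n + 1) = 0 := by
  have h := (fermSq_partial_pow (m := m) (Finset.univ : Finset (Fin n))).1
  rwa [Finset.card_fin] at h

theorem fermVector_pow_eq_zero (m n : ℕ) : fermVector m n ^ (2 * n + 1) = 0 := by
  have h := (fermSq_partial_pow (m := m) (Finset.univ : Finset (Fin n))).2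
  rw [Finset.card_fin] at h
  have hc : ∀ k : FermIdx n, Commute (eFerm k) (fermSq m n) := fun k =>
    Commute.sum_right _ _ _ fun j _ =>
      Commute.mul_right (eFerm_mul_xFerm _ _) (eFerm_mul_xFerm _ _)
  rw [pow_succ', pow_mul, sq, fermVector_sq, fermVector, Finset.sum_mul]
  refine Finset.sum_eq_zero fun k _ => ?_
  rw [mul_assoc, ((hc k).pow_right n).eq, ← mul_assoc]
  rcases k with j | j
  · exact (congrArg (· * _) (h j (Finset.mem_univ j)).1).trans (zero_mul _)
  · exact (congrArg (· * _) (h j (Finset.mem_univ j)).2).trans (zero_mul _)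

/-! ### The fermionic Dirac operator on powers of the supervector variable -/

theorem fermDeriv_one {m n : ℕ} (k : FermIdx n) : fermDeriv k (1 : SuperVal m n) = 0 := by
  rw [fermDeriv, Algebra.TensorProduct.one_def, LinearMap.rTensor_tmul]
  erw [CliffordAlgebra.contractLeft_one]
  rw [TensorProduct.zero_tmul]

theorem fermDeriv_one_tmul_mul {m n : ℕ} (k : FermIdx n) (c : SuperClifford m n)
    (a : SuperVal m n) : fermDeriv k ((1 ⊗ₜ c) * a) = (1 ⊗ₜ c) * fermDeriv k a := by
  induction a using TensorProduct.induction_on with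
  | zero => simp
  | add a b ha hb => rw [mul_add, map_add, map_add, mul_add, ha, hb]
  | tmul a b =>
    simp only [fermDeriv, Algebra.TensorProduct.tmul_mul_tmul, one_mul, LinearMap.rTensor_tmul]

theorem fermDeriv_fermVector_mul {m n : ℕ} (k : FermIdx n) (a : SuperVal m n) :
    fermDeriv k (fermVector m n * a) = eFerm k * a - fermVector m n * fermDeriv k a := by
  classical
  rw [eq_sub_iff_add_eq, fermVector, Finset.sum_mul, Finset.sum_mul, map_sum,
    ← Finset.sum_add_distrib]
  have h : ∀ i : FermIdx n, fermDeriv k (xFerm i * eFerm i * a) + xFerm i * eFerm i * fermDeriv k a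
      = if k = i then eFerm i * a else 0 := fun i => by
    rw [← fermDeriv_xFerm_mul k i (eFerm i * a), mul_assoc, mul_assoc, eFerm,
      fermDeriv_one_tmul_mul]
  simp [h]

theorem fermDeriv_bosVector_mul {m n : ℕ} (x : Fin m → ℝ) (k : FermIdx n) (a : SuperVal m n) :
    fermDeriv k (bosVector n x * a) = bosVector n x * fermDeriv k a := by
  simp only [bosVector, Finset.sum_mul, map_sum, smul_mul_assoc, map_smul, eBos,
    fermDeriv_one_tmul_mul]

theorem eFerm_inl_mul_fermVector {m n : ℕ} (j : Fin n) :
    eFerm (Sum.inl j) * fermVector m n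
      = fermVector m n * eFerm (Sum.inl j) + xFerm (Sum.inr j) := by
  have h : ∀ k : FermIdx n, (eFerm (Sum.inl j) * (xFerm k * eFerm k) : SuperVal m n)
      = xFerm k * eFerm k * eFerm (Sum.inl j) + symplecticForm (Sum.inl j) k • xFerm k :=
    fun k => by
      rw [← mul_assoc, eFerm_mul_xFerm, mul_assoc, eFerm_mul_swap, mul_add, mul_smul_comm,
        mul_one, mul_assoc]
  rw [fermVector, Finset.mul_sum, Finset.sum_mul, Finset.sum_congr rfl fun k _ => h k,
    Finset.sum_add_distrib]
  congr 1
  simp [Fintype.sum_sum_type, symplecticForm]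

theorem eFerm_inr_mul_fermVector {m n : ℕ} (j : Fin n) :
    eFerm (Sum.inr j) * fermVector m n
      = fermVector m n * eFerm (Sum.inr j) - xFerm (Sum.inl j) := by
  have h : ∀ k : FermIdx n, (eFerm (Sum.inr j) * (xFerm k * eFerm k) : SuperVal m n)
      = xFerm k * eFerm k * eFerm (Sum.inr j) + symplecticForm (Sum.inr j) k • xFerm k :=
    fun k => by
      rw [← mul_assoc, eFerm_mul_xFerm, mul_assoc, eFerm_mul_swap, mul_add, mul_smul_comm,
        mul_one, mul_assoc]
  rw [fermVector, Finset.mul_sum, Finset.sum_mul, Finset.sum_congr rfl fun k _ => h k,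
    Finset.sum_add_distrib, sub_eq_add_neg]
  congr 1
  simp [Fintype.sum_sum_type, symplecticForm]

theorem xFerm_mul_fermVector {m n : ℕ} (k : FermIdx n) :
    xFerm k * fermVector m n = -(fermVector m n * xFerm k) := by
  rw [fermVector, Finset.mul_sum, Finset.sum_mul, ← Finset.sum_neg_distrib]
  refine Finset.sum_congr rfl fun i _ => ?_
  rw [← mul_assoc, xFerm_mul_swap, mul_assoc, eFerm_mul_xFerm, neg_mul, mul_assoc]

/-- The fermionic Euler operator `∑ x'_k ∂_{x'_k}`. -/
def fermEuler {m n : ℕ} (a : SuperVal m n) : SuperVal m n := ∑ k, xFerm k * fermDeriv k a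

theorem fermEuler_fermVector_mul {m n : ℕ} (a : SuperVal m n) :
    fermEuler (fermVector m n * a) = fermVector m n * a + fermVector m n * fermEuler a := by
  have h : ∀ k : FermIdx n, xFerm k * fermDeriv k (fermVector m n * a)
      = xFerm k * eFerm k * a + fermVector m n * (xFerm k * fermDeriv k a) := fun k => by
    rw [fermDeriv_fermVector_mul, mul_sub, ← mul_assoc, ← mul_assoc (xFerm k),
      xFerm_mul_fermVector, neg_mul, sub_neg_eq_add, mul_assoc (fermVector m n)]
  rw [fermEuler, Finset.sum_congr rfl fun k _ => h k, Finset.sum_add_distrib, ← Finset.sum_mul,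
    ← Finset.mul_sum]
  rfl

theorem fermEuler_fermVector_pow (m n j : ℕ) :
    fermEuler (fermVector m n ^ j) = (j : ℝ) • fermVector m n ^ j := by
  induction j with
  | zero => simp [fermEuler, fermDeriv_one]
  | succ j ih =>
    rw [pow_succ', fermEuler_fermVector_mul, ih, mul_smul_comm]
    push_cast
    module

theorem fermDirac_fermVector_mul {m n : ℕ} (a : SuperVal m n) :
    fermDirac (fermVector m n * a)
      = (-(2 * n : ℝ)) • a - fermVector m n * fermDirac a + (2 : ℝ) • fermEuler a := by
  have h : ∀ j : Fin n,
      eFerm (Sum.inr j) * fermDeriv (Sum.inl j) (fermVector m n * a)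
          - eFerm (Sum.inl j) * fermDeriv (Sum.inr j) (fermVector m n * a)
        = -a - fermVector m n * (eFerm (Sum.inr j) * fermDeriv (Sum.inl j) a
            - eFerm (Sum.inl j) * fermDeriv (Sum.inr j) a)
          + (xFerm (Sum.inl j) * fermDeriv (Sum.inl j) a
            + xFerm (Sum.inr j) * fermDeriv (Sum.inr j) a) := fun j => by
    rw [fermDeriv_fermVector_mul, fermDeriv_fermVector_mul, mul_sub, mul_sub, ← mul_assoc,
      ← mul_assoc (eFerm (Sum.inr j)) (fermVector m n), ← mul_assoc,
      ← mul_assoc (eFerm (Sum.inl j)) (fermVector m n),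
      eFerm_inl_mul_fermVector, eFerm_inr_mul_fermVector, eFerm_mul_swap (Sum.inl j) (Sum.inr j)]
    simp only [symplecticForm, if_true, add_mul, sub_mul, one_smul, one_mul, mul_sub, mul_assoc]
    abel
  rw [fermDirac, Finset.sum_congr rfl fun j _ => h j, Finset.sum_add_distrib,
    Finset.sum_sub_distrib, Finset.sum_const, Finset.card_fin, ← Finset.mul_sum,
    Finset.sum_add_distrib, fermEuler, Fintype.sum_sum_type, fermDirac, mul_smul_comm,
    ← Nat.cast_smul_eq_nsmul ℝ]
  module

/-- The coefficients in `∂_𝐱 𝐱^j = c_j 𝐱^{j-1}`: `c_{2s} = 2s` and `c_{2s+1} = M + 2s`. -/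
def diracCoeff (m n j : ℕ) : ℝ := if Even j then (j : ℝ) else (superDim m n : ℝ) + (j - 1)

theorem diracCoeff_even (m n s : ℕ) : diracCoeff m n (2 * s) = 2 * s := by
  simp [diracCoeff]

theorem diracCoeff_odd (m n s : ℕ) : diracCoeff m n (2 * s + 1) = superDim m n + 2 * s := by
  simp [diracCoeff]

theorem diracCoeff_succ_add (m n j : ℕ) :
    diracCoeff m n (j + 1) + diracCoeff m n j = superDim m n + 2 * j := by
  rcases Nat.even_or_odd' j with ⟨s, rfl | rfl⟩
  · rw [diracCoeff_even, diracCoeff_odd]; push_cast; ring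
  · rw [diracCoeff_odd, show 2 * s + 1 + 1 = 2 * (s + 1) by ring, diracCoeff_even]; push_cast; ring

theorem superDim_zero (n : ℕ) : (superDim 0 n : ℝ) = -(2 * n) := by simp [superDim]

theorem fermDirac_one (m n : ℕ) : fermDirac (1 : SuperVal m n) = 0 := by
  simp [fermDirac, fermDeriv_one]

/-- The Euler operator turns the anticommutator formula `fermDirac_fermVector_mul` into a recursion
for the coefficients. -/
theorem fermDirac_fermVector_pow (m n j : ℕ) :
    fermDirac (fermVector m n ^ (j + 1)) = diracCoeff 0 n (j + 1) • fermVector m n ^ j := by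
  induction j with
  | zero =>
    rw [zero_add, pow_one, ← mul_one (fermVector m n), fermDirac_fermVector_mul, fermDirac_one]
    have h := diracCoeff_odd 0 n 0
    rw [superDim_zero] at h
    simp at h
    simp [h, fermEuler, fermDeriv_one]
  | succ j ih =>
    rw [pow_succ' _ (j + 1), fermDirac_fermVector_mul, ih, fermEuler_fermVector_pow,
      mul_smul_comm, ← pow_succ']
    have h := diracCoeff_succ_add 0 n (j + 1)
    rw [superDim_zero, ← eq_sub_iff_add_eq] at h
    rw [h]
    module

theorem fermDirac_add {m n : ℕ} (a b : SuperVal m n) :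
    fermDirac (a + b) = fermDirac a + fermDirac b := by
  simp only [fermDirac, map_add, mul_add, ← smul_add, ← Finset.sum_add_distrib]
  congr 1
  exact Finset.sum_congr rfl fun j _ => by abel

theorem fermDirac_smul {m n : ℕ} (c : ℝ) (a : SuperVal m n) :
    fermDirac (c • a) = c • fermDirac a := by
  simp only [fermDirac, map_smul, mul_smul_comm, ← smul_sub, ← Finset.smul_sum]
  rw [smul_comm]

/-- `fermDirac` as a linear map. -/
def fermDiracL (m n : ℕ) : SuperVal m n →ₗ[ℝ] SuperVal m n where
  toFun := fermDirac
  map_add' := fermDirac_add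
  map_smul' := fermDirac_smul

theorem diracCoeff_zero_ne_zero {n j : ℕ} (h0 : 0 < j) (h : j ≤ 2 * n) :
    diracCoeff 0 n j ≠ 0 := by
  rcases Nat.even_or_odd' j with ⟨s, rfl | rfl⟩
  · rw [diracCoeff_even]
    have : (0 : ℝ) < s := by exact_mod_cast (by omega : 0 < s)
    positivity
  · rw [diracCoeff_odd, superDim_zero]
    have : (s : ℝ) < n := by exact_mod_cast (by omega : s < n)
    intro h; linarith

/-- The fermionic Dirac operator lowers the power `Θ^j` with a nonzero factor as long as
`j ≤ 2n`, so that none of these powers vanishes. -/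
theorem fermVector_pow_ne_zero {m n j : ℕ} (h : j ≤ 2 * n) : fermVector m n ^ j ≠ 0 := by
  induction j with
  | zero => simp
  | succ j ih =>
    intro h0
    have h1 := fermDirac_fermVector_pow m n j
    rw [h0] at h1
    have h2 : fermDirac (0 : SuperVal m n) = 0 := (fermDiracL m n).map_zero
    rw [h2] at h1
    exact smul_ne_zero (diracCoeff_zero_ne_zero j.succ_pos h) (ih (by omega)) h1.symm

theorem fermVector_pow_coeff_eq_zero {m n : ℕ} {g : ℕ → ℝ}
    (h : ∑ j ∈ Finset.range (2 * n + 1), g j • fermVector m n ^ j = 0) :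
    ∀ j ≤ 2 * n, g j = 0 := by
  intro j
  induction j using Nat.strong_induction_on with
  | _ j ih =>
    intro hj
    -- multiplying by `Θ^{2n-j}` kills all terms of degree larger than `j`
    have h1 : (∑ i ∈ Finset.range (2 * n + 1), g i • fermVector m n ^ i)
        * fermVector m n ^ (2 * n - j) = g j • fermVector m n ^ (2 * n) := by
      rw [Finset.sum_mul, Finset.sum_eq_single j]
      · rw [smul_mul_assoc, ← pow_add, Nat.add_sub_cancel' hj]
      · intro i _ hij
        rcases lt_or_gt_of_ne hij with hlt | hgt
        · rw [ih i hlt (by omega), zero_smul, zero_mul]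
        · rw [smul_mul_assoc, ← pow_add, show i + (2 * n - j) = 2 * n + 1 + (i - j - 1) by omega,
            pow_add, fermVector_pow_eq_zero, zero_mul, smul_zero]
      · intro h'; exact absurd (Finset.mem_range.2 (by omega)) h'
    rw [h, zero_mul] at h1
    exact (smul_eq_zero.1 h1.symm).resolve_right (fermVector_pow_ne_zero le_rfl)

/-! ### The body of the powers of the supervector variable and of their fermionic derivatives -/

theorem body_fermVector (m n : ℕ) : body m n (fermVector m n) = 0 := by
  simp [fermVector, body_xFerm]

/-- The Clifford vector `∑ x_j e_j`. -/
def bodyVector {m : ℕ} (n : ℕ) (x : Fin m → ℝ) : SuperClifford m n :=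
  ∑ j, x j • cliffordGen m n (Sum.inl j)

theorem body_bosVector {m : ℕ} (n : ℕ) (x : Fin m → ℝ) :
    body m n (bosVector n x) = bodyVector n x := by
  simp [bosVector, bodyVector, body_eBos]

theorem body_superVector {m : ℕ} (n : ℕ) (x : Fin m → ℝ) :
    body m n (superVector n x) = bodyVector n x := by
  rw [superVector_eq, map_add, body_fermVector, add_zero, body_bosVector]

theorem bodyVector_sq {m : ℕ} (n : ℕ) (x : Fin m → ℝ) :
    bodyVector n x ^ 2 = (-∑ j, x j ^ 2) • 1 := by
  rw [← body_bosVector, ← map_pow, sq, bosVector_sq, map_smul, map_one]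

theorem bodyVector_pow_even {m : ℕ} (n : ℕ) (x : Fin m → ℝ) (s : ℕ) :
    bodyVector n x ^ (2 * s) = ((-∑ j, x j ^ 2) ^ s) • 1 := by
  rw [pow_mul, bodyVector_sq, smul_pow, one_pow]

theorem bodyVector_pow_odd {m : ℕ} (n : ℕ) (x : Fin m → ℝ) (s : ℕ) :
    bodyVector n x ^ (2 * s + 1) = ((-∑ j, x j ^ 2) ^ s) • bodyVector n x := by
  rw [pow_succ, bodyVector_pow_even, smul_one_mul]

theorem body_fermDeriv_superVector_mul {m n : ℕ} (x : Fin m → ℝ) (k : FermIdx n)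
    (a : SuperVal m n) :
    body m n (fermDeriv k (superVector n x * a))
      = bodyVector n x * body m n (fermDeriv k a)
        + cliffordGen m n (Sum.inr k) * body m n a := by
  rw [superVector_eq, add_mul, map_add, fermDeriv_bosVector_mul, fermDeriv_fermVector_mul,
    map_add, map_mul, map_sub, map_mul, map_mul, body_bosVector, body_fermVector, body_eFerm,
    zero_mul, sub_zero]

theorem bodyVector_mul_cliffordGen_inr {m n : ℕ} (x : Fin m → ℝ) (k : FermIdx n) :
    bodyVector n x * cliffordGen m n (Sum.inr k)
      = -(cliffordGen m n (Sum.inr k) * bodyVector n x) := by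
  rw [bodyVector, Finset.sum_mul, Finset.mul_sum, ← Finset.sum_neg_distrib]
  refine Finset.sum_congr rfl fun j _ => ?_
  rw [smul_mul_assoc, cliffordGen_mixed, mul_smul_comm, smul_neg]

theorem body_fermDeriv_superVector_pow_even {m n : ℕ} (x : Fin m → ℝ) (k : FermIdx n) (s : ℕ) :
    body m n (fermDeriv k (superVector n x ^ (2 * s))) = 0 := by
  induction s with
  | zero => simp [fermDeriv_one]
  | succ s ih =>
    rw [show 2 * (s + 1) = 2 * s + 1 + 1 by ring, pow_succ', body_fermDeriv_superVector_mul,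
      pow_succ', body_fermDeriv_superVector_mul, ih, mul_zero, zero_add, ← mul_assoc,
      bodyVector_mul_cliffordGen_inr, map_mul, body_superVector, neg_mul, mul_assoc,
      neg_add_cancel]

theorem body_fermDeriv_superVector_pow_odd {m n : ℕ} (x : Fin m → ℝ) (k : FermIdx n) (s : ℕ) :
    body m n (fermDeriv k (superVector n x ^ (2 * s + 1)))
      = ((-∑ j, x j ^ 2) ^ s) • cliffordGen m n (Sum.inr k) := by
  rw [pow_succ', body_fermDeriv_superVector_mul, body_fermDeriv_superVector_pow_even, mul_zero,
    zero_add, map_pow, body_superVector, bodyVector_pow_even, mul_smul_comm, mul_one]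

theorem body_fermDirac {m n : ℕ} (a : SuperVal m n) :
    body m n (fermDirac a) = (2 : ℝ) • ∑ j : Fin n,
      (cliffordGen m n (Sum.inr (Sum.inr j)) * body m n (fermDeriv (Sum.inl j) a)
        - cliffordGen m n (Sum.inr (Sum.inl j)) * body m n (fermDeriv (Sum.inr j) a)) := by
  simp only [fermDirac, map_smul, map_sum, map_sub, map_mul, body_eFerm]

theorem body_fermDirac_superVector_pow_even {m n : ℕ} (x : Fin m → ℝ) (s : ℕ) :
    body m n (fermDirac (superVector n x ^ (2 * s))) = 0 := by
  simp [body_fermDirac, body_fermDeriv_superVector_pow_even]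

theorem body_fermDirac_superVector_pow_odd {m n : ℕ} (x : Fin m → ℝ) (s : ℕ) :
    body m n (fermDirac (superVector n x ^ (2 * s + 1)))
      = (-(2 * n) * (-∑ j, x j ^ 2) ^ s) • 1 := by
  simp only [body_fermDirac, body_fermDeriv_superVector_pow_odd, mul_smul_comm, ← smul_sub]
  have h : ∀ j : Fin n,
      cliffordGen m n (Sum.inr (Sum.inr j)) * cliffordGen m n (Sum.inr (Sum.inl j))
      - cliffordGen m n (Sum.inr (Sum.inl j)) * cliffordGen m n (Sum.inr (Sum.inr j))
      = (-1 : ℝ) • 1 := fun j => by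
    rw [cliffordGen_sympl (Sum.inr j) (Sum.inl j), add_sub_cancel_left,
      Algebra.algebraMap_eq_smul_one]
    simp [symplecticForm]
  simp only [h, Finset.sum_const, Finset.card_fin, smul_smul, ← Nat.cast_smul_eq_nsmul ℝ]
  congr 1
  ring

/-! ### Real power series with coefficients of geometric growth -/

theorem summable_of_bounded_mul_pow {a : ℕ → ℝ} {R C ρ : ℝ} (ha : ∀ j, |a j| * R ^ j ≤ C)
    (hρ : |ρ| < R) : Summable fun j => a j * ρ ^ j := by
  have hR : 0 < R := (abs_nonneg _).trans_lt hρ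
  refine Summable.of_norm_bounded ((summable_geometric_of_lt_one (by positivity)
    ((div_lt_one hR).2 hρ)).mul_left C) fun j => ?_
  calc ‖a j * ρ ^ j‖ = (|a j| * R ^ j) * (|ρ| / R) ^ j := by
        rw [Real.norm_eq_abs, abs_mul, abs_pow, div_pow]; field_simp
    _ ≤ C * (|ρ| / R) ^ j := by gcongr; exact ha j

theorem hasDerivAt_tsum_mul_pow {a : ℕ → ℝ} {R C ρ : ℝ} (ha : ∀ j, |a j| * R ^ j ≤ C)
    (hρ : |ρ| < R) :
    ∃ D, HasDerivAt (fun z => ∑' j, a j * z ^ j) D ρ ∧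
      HasSum (fun j => a j * (j * ρ ^ (j - 1))) D := by
  have hR : 0 < R := (abs_nonneg _).trans_lt hρ
  obtain ⟨R', h1, h2⟩ := exists_between hρ
  have hR' : 0 < R' := (abs_nonneg _).trans_lt h1
  have hC : 0 ≤ C := (by positivity : (0 : ℝ) ≤ |a 0| * R ^ 0).trans (ha 0)
  have hq : ‖R' / R‖ < 1 := by
    rw [Real.norm_of_nonneg (by positivity)]; exact (div_lt_one hR).2 h2
  have hu : Summable fun j : ℕ => C / R' * ((j : ℝ) ^ 1 * (R' / R) ^ j) :=
    (summable_pow_mul_geometric_of_norm_lt_one 1 hq).mul_left _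
  have hbound : ∀ (j : ℕ) (y : ℝ), y ∈ Ioo (-R') R' →
      ‖a j * (j * y ^ (j - 1))‖ ≤ C / R' * ((j : ℝ) ^ 1 * (R' / R) ^ j) := by
    intro j y hy
    have hy' : |y| ≤ R' := (abs_lt.2 hy).le
    rcases j with _ | j
    · simp
    · rw [Real.norm_eq_abs, abs_mul, abs_mul, abs_pow, Nat.add_sub_cancel, Nat.abs_cast]
      calc |a (j + 1)| * (((j + 1 : ℕ) : ℝ) * |y| ^ j)
          ≤ |a (j + 1)| * (((j + 1 : ℕ) : ℝ) * R' ^ j) := by gcongr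
        _ = (|a (j + 1)| * R ^ (j + 1)) / R' * (((j + 1 : ℕ) : ℝ) ^ 1 * (R' / R) ^ (j + 1)) := by
            rw [div_pow, pow_succ R', pow_one]; field_simp
        _ ≤ C / R' * (((j + 1 : ℕ) : ℝ) ^ 1 * (R' / R) ^ (j + 1)) := by
            gcongr; exact ha _
  have hρ' : ρ ∈ Ioo (-R') R' := abs_lt.1 h1
  have hder : ∀ (j : ℕ) (y : ℝ), y ∈ Ioo (-R') R' →
      HasDerivAt (fun z => a j * z ^ j) (a j * (j * y ^ (j - 1))) y :=
    fun j y _ => (hasDerivAt_pow j y).const_mul (a j)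
  have hsum : Summable fun j : ℕ => a j * (j * ρ ^ (j - 1)) :=
    Summable.of_norm_bounded hu fun j => hbound j ρ hρ'
  exact ⟨_, hasDerivAt_tsum_of_isPreconnected hu isOpen_Ioo isPreconnected_Ioo hder hbound hρ'
    (summable_of_bounded_mul_pow ha hρ) hρ', hsum.hasSum⟩

/-- If `ν` is nilpotent, then a power series that converges at some `R > ρ` converges absolutely,
coefficientwise, at `ρ + ν`: expanding `(ρ + ν)^j` leaves finitely many powers of `ν`. -/
theorem exists_hasSum_smul_pow_of_nilpotent {A : Type*} [Ring A] [Algebra ℝ A] {ν : A} {K : ℕ}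
    (hν : ν ^ K = 0) {g : ℕ → ℝ} {R C ρ : ℝ} (hg : ∀ j, |g j| * R ^ j ≤ C) (h0 : 0 ≤ ρ)
    (hρ : ρ < R) :
    ∃ S : A, ∀ l : Module.Dual ℝ A, HasSum (fun j => l (g j • (ρ • (1 : A) + ν) ^ j)) (l S) := by
  have hR : 0 < R := h0.trans_lt hρ
  have hC : 0 ≤ C := (by positivity : (0 : ℝ) ≤ |g 0| * R ^ 0).trans (hg 0)
  have hs : ∀ i : ℕ, Summable fun j => g j * (j.choose i * ρ ^ (j - i)) := by
    intro i
    rw [← summable_nat_add_iff i]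
    refine Summable.of_norm_bounded ((summable_choose_mul_geometric_of_norm_lt_one i
      (r := ρ / R) ?_).mul_left (C / R ^ i)) fun j => ?_
    · rw [Real.norm_of_nonneg (by positivity)]; exact (div_lt_one hR).2 hρ
    · rw [Real.norm_eq_abs, abs_mul, Nat.add_sub_cancel, abs_of_nonneg
        (by positivity : (0 : ℝ) ≤ (j + i).choose i * ρ ^ j)]
      calc |g (j + i)| * ((j + i).choose i * ρ ^ j)
          = (|g (j + i)| * R ^ (j + i)) / R ^ i * ((j + i).choose i * (ρ / R) ^ j) := by
            rw [div_pow, pow_add]; field_simp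
        _ ≤ _ := by gcongr; exact hg _
  refine ⟨∑ i ∈ Finset.range K, (∑' j, g j * (j.choose i * ρ ^ (j - i))) • ν ^ i, fun l => ?_⟩
  have hpow : ∀ j, (ρ • (1 : A) + ν) ^ j
      = ∑ i ∈ Finset.range K, ((j.choose i : ℝ) * ρ ^ (j - i)) • ν ^ i := by
    intro j
    rw [add_comm, (((Commute.one_right ν).smul_right ρ)).add_pow]
    have hterm : ∀ i, ν ^ i * (ρ • (1 : A)) ^ (j - i) * (j.choose i : A)
        = ((j.choose i : ℝ) * ρ ^ (j - i)) • ν ^ i := fun i => by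
      rw [smul_pow, one_pow, mul_smul_comm, mul_one, smul_mul_assoc, ← nsmul_eq_mul', mul_comm,
        mul_smul, Nat.cast_smul_eq_nsmul]
    simp only [hterm]
    rcases le_total (j + 1) K with h | h
    · refine Finset.sum_subset (Finset.range_mono h) fun i _ hi => ?_
      rw [Nat.choose_eq_zero_of_lt (by simpa using hi)]; simp
    · refine (Finset.sum_subset (Finset.range_mono h) fun i _ hi => ?_).symm
      rw [← Nat.add_sub_cancel' (not_lt.1 (mt Finset.mem_range.2 hi)), pow_add, hν, zero_mul,
        smul_zero]
  simp only [map_smul, hpow, map_sum, smul_eq_mul, Finset.mul_sum]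
  refine hasSum_sum fun i _ => ?_
  simpa only [mul_assoc] using (hs i).hasSum.mul_right (l (ν ^ i))

/-! ### Taylor coefficients of smooth functions of two variables -/

theorem iteratedDeriv_zero_of_hasSum {f : ℝ → ℝ} {a : ℕ → ℝ}
    (h : ∀ᶠ z in 𝓝 (0 : ℝ), HasSum (fun j => a j * z ^ j) (f z)) (j : ℕ) :
    iteratedDeriv j f 0 = j.factorial * a j := by
  have hp : HasFPowerSeriesAt f (FormalMultilinearSeries.ofScalars ℝ a) 0 := by
    rw [hasFPowerSeriesAt_iff]
    filter_upwards [h] with z hz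
    simpa [FormalMultilinearSeries.coeff_ofScalars, mul_comm] using hz
  obtain ⟨r, hr⟩ := hp
  rw [iteratedDeriv_eq_iteratedFDeriv, ← hr.factorial_smul]
  simp [FormalMultilinearSeries.ofScalars]

section

variable {E : Type*} [NormedAddCommGroup E] [NormedSpace ℝ E]

/-- The directional derivative of a differentiable function. -/
noncomputable def dirDeriv (v : E) (f : E → ℝ) (p : E) : ℝ := fderiv ℝ f p v

theorem contDiffOn_dirDeriv {U : Set E} (hU : IsOpen U) {f : E → ℝ} (hf : ContDiffOn ℝ ∞ f U)
    (v : E) : ContDiffOn ℝ ∞ (dirDeriv v f) U :=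
  (hf.fderiv_of_isOpen hU (by simp)).clm_apply contDiffOn_const

theorem contDiffOn_iterate_dirDeriv {U : Set E} (hU : IsOpen U) {f : E → ℝ}
    (hf : ContDiffOn ℝ ∞ f U) (v : E) (j : ℕ) : ContDiffOn ℝ ∞ ((dirDeriv v)^[j] f) U := by
  induction j generalizing f with
  | zero => exact hf
  | succ j ih => exact ih (contDiffOn_dirDeriv hU hf v)

theorem dirDeriv_congr {U : Set E} (hU : IsOpen U) {f g : E → ℝ} (h : EqOn f g U) (v : E) :
    EqOn (dirDeriv v f) (dirDeriv v g) U := fun p hp => by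
  rw [dirDeriv, dirDeriv, (h.eventuallyEq_of_mem (hU.mem_nhds hp)).fderiv_eq]

theorem iterate_dirDeriv_congr {U : Set E} (hU : IsOpen U) {f g : E → ℝ} (h : EqOn f g U) (v : E)
    (j : ℕ) : EqOn ((dirDeriv v)^[j] f) ((dirDeriv v)^[j] g) U := by
  induction j generalizing f g with
  | zero => exact h
  | succ j ih => exact ih (dirDeriv_congr hU h v)

theorem dirDeriv_comm {U : Set E} (hU : IsOpen U) {f : E → ℝ} (hf : ContDiffOn ℝ ∞ f U) (v w : E) :
    EqOn (dirDeriv v (dirDeriv w f)) (dirDeriv w (dirDeriv v f)) U := by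
  intro p hp
  have hfp : ContDiffAt ℝ ∞ f p := hf.contDiffAt (hU.mem_nhds hp)
  have hd : DifferentiableAt ℝ (fderiv ℝ f) p :=
    (hfp.fderiv_right (m := 1) (by norm_cast)).differentiableAt one_ne_zero
  have h : ∀ v w, dirDeriv v (dirDeriv w f) p = fderiv ℝ (fderiv ℝ f) p v w := fun v w => by
    change fderiv ℝ (fun q => fderiv ℝ f q w) p v = _
    rw [fderiv_clm_apply hd (differentiableAt_const _)]
    simp
  rw [h, h]
  exact (hfp.isSymmSndFDerivAt (by
    rw [minSmoothness_of_isRCLikeNormedField]; norm_cast)) v w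

theorem dirDeriv_iterate_comm {U : Set E} (hU : IsOpen U) {f : E → ℝ} (hf : ContDiffOn ℝ ∞ f U)
    (v w : E) (j : ℕ) :
    EqOn (dirDeriv w ((dirDeriv v)^[j] f)) ((dirDeriv v)^[j] (dirDeriv w f)) U := by
  induction j generalizing f with
  | zero => exact fun _ _ => rfl
  | succ j ih =>
    exact (ih (contDiffOn_dirDeriv hU hf v)).trans
      (iterate_dirDeriv_congr hU (dirDeriv_comm hU hf w v) v j)

end

theorem hasDerivAt_snd_dirDeriv {U : Set (ℝ × ℝ)} (hU : IsOpen U) {f : ℝ × ℝ → ℝ}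
    (hf : ContDiffOn ℝ ∞ f U) {t z : ℝ} (h : (t, z) ∈ U) :
    HasDerivAt (fun z => f (t, z)) (dirDeriv (0, 1) f (t, z)) z :=
  ((hf.contDiffAt (hU.mem_nhds h)).differentiableAt (by simp)).hasFDerivAt.comp_hasDerivAt z
    ((hasDerivAt_const z t).prodMk (hasDerivAt_id z))

theorem hasDerivAt_fst_dirDeriv {U : Set (ℝ × ℝ)} (hU : IsOpen U) {f : ℝ × ℝ → ℝ}
    (hf : ContDiffOn ℝ ∞ f U) {t z : ℝ} (h : (t, z) ∈ U) :
    HasDerivAt (fun t => f (t, z)) (dirDeriv (1, 0) f (t, z)) t :=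
  ((hf.contDiffAt (hU.mem_nhds h)).differentiableAt (by simp)).hasFDerivAt.comp_hasDerivAt t
    ((hasDerivAt_id t).prodMk (hasDerivAt_const t z))

theorem iteratedDeriv_snd_eq {U : Set (ℝ × ℝ)} (hU : IsOpen U) {f : ℝ × ℝ → ℝ}
    (hf : ContDiffOn ℝ ∞ f U) (j : ℕ) {t z : ℝ} (h : (t, z) ∈ U) :
    iteratedDeriv j (fun z => f (t, z)) z = (dirDeriv (0, 1))^[j] f (t, z) := by
  induction j generalizing z with
  | zero => simp
  | succ j ih =>
    have hev : iteratedDeriv j (fun z => f (t, z)) =ᶠ[𝓝 z]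
        fun z => (dirDeriv (0, 1))^[j] f (t, z) := by
      have hc : Continuous fun z : ℝ => (t, z) := by fun_prop
      filter_upwards [hc.continuousAt.preimage_mem_nhds (hU.mem_nhds h)] with y hy
      exact ih hy
    rw [iteratedDeriv_succ, hev.deriv_eq, Function.iterate_succ_apply']
    exact (hasDerivAt_snd_dirDeriv hU (contDiffOn_iterate_dirDeriv hU hf _ j) h).deriv

/-- If a smooth function of `(t, z)` has a power series expansion `∑ a_j(t) z^j` for each `t`, and
if its `t`-derivative at `t₀` has the expansion `∑ b_j z^j`, then `a_j'(t₀) = b_j`. No uniformity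
of the expansions in `t` is needed, because `∂_t` commutes with the `z`-derivatives at `z = 0`. -/
theorem hasDerivAt_coeff_of_contDiffOn {U : Set (ℝ × ℝ)} (hU : IsOpen U) {f : ℝ × ℝ → ℝ}
    (hf : ContDiffOn ℝ ∞ f U) {a : ℕ → ℝ → ℝ} {b : ℕ → ℝ} {t₀ : ℝ} (h₀ : (t₀, 0) ∈ U)
    (ha : ∀ᶠ t in 𝓝 t₀, ∀ᶠ z in 𝓝 (0 : ℝ), HasSum (fun j => a j t * z ^ j) (f (t, z)))
    (hb : ∀ᶠ z in 𝓝 (0 : ℝ), HasSum (fun j => b j * z ^ j) (dirDeriv (1, 0) f (t₀, z))) (j : ℕ) :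
    HasDerivAt (a j) (b j) t₀ := by
  have h1 := hasDerivAt_fst_dirDeriv hU (contDiffOn_iterate_dirDeriv hU hf (0, 1) j) h₀
  rw [dirDeriv_iterate_comm hU hf (0, 1) (1, 0) j h₀,
    ← iteratedDeriv_snd_eq hU (contDiffOn_dirDeriv hU hf _) j h₀,
    iteratedDeriv_zero_of_hasSum hb] at h1
  have hfac : (j.factorial : ℝ) ≠ 0 := by positivity
  have h2 : (fun t => (j.factorial : ℝ) * a j t)
      =ᶠ[𝓝 t₀] fun t => (dirDeriv (0, 1))^[j] f (t, 0) := by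
    have hc : Continuous fun t : ℝ => (t, (0 : ℝ)) := by fun_prop
    filter_upwards [ha, hc.continuousAt.preimage_mem_nhds (hU.mem_nhds h₀)] with t ht htU
    rw [← iteratedDeriv_snd_eq hU hf j htU, iteratedDeriv_zero_of_hasSum ht]
  have h3 := (h1.congr_of_eventuallyEq h2).const_mul ((j.factorial : ℝ)⁻¹)
  simpa [hfac] using h3

/-! ### Growth of the coefficients and the body of the sum -/

/-- A linear image of the sum of a coefficientwise convergent series is determined by the sums of
the image series. -/
theorem SeriesConvergesTo.map_eq {m n : ℕ} {V : Type*} [AddCommGroup V] [Module ℝ V]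
    {u : ℕ → SuperVal m n} {S : SuperVal m n} (h : SeriesConvergesTo u S)
    (L : SuperVal m n →ₗ[ℝ] V) {T : V}
    (hT : ∀ l : Module.Dual ℝ V, HasSum (fun j => l (L (u j))) (l T)) : L S = T := by
  rw [← sub_eq_zero, ← Module.forall_dual_apply_eq_zero_iff ℝ]
  intro l
  rw [map_sub, sub_eq_zero]
  refine tendsto_nhds_unique (h (l ∘ₗ L)) ?_
  simpa using (hT l).tendsto_sum_nat

theorem SeriesConvergesTo.exists_bound {m n : ℕ} {u : ℕ → SuperVal m n} {S : SuperVal m n}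
    (h : SeriesConvergesTo u S) (l : Module.Dual ℝ (SuperVal m n)) : ∃ C, ∀ j, |l (u j)| ≤ C := by
  have h1 : Tendsto (fun N => l (u N)) atTop (𝓝 (l S - l S)) := by
    refine (((tendsto_add_atTop_iff_nat 1).2 (h l)).sub (h l)).congr fun N => ?_
    rw [Finset.sum_range_succ, map_add, add_sub_cancel_left]
  obtain ⟨C, hC⟩ := h1.norm.bddAbove_range
  exact ⟨C, fun j => hC ⟨j, rfl⟩⟩

/-- Convergence of `∑ u_j 𝐱^j` bounds the numbers `|u_j| r^j`, where `r` is the Euclidean norm of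
the bosonic part of `𝐱`: the even and the odd powers of the body of `𝐱` are multiples of two
fixed nonzero elements. -/
theorem exists_bound_of_seriesConvergesTo {m n : ℕ} {u : ℕ → ℝ} {x : Fin m → ℝ}
    {S : SuperVal m n} (h : SeriesConvergesTo (fun j => u j • superVector n x ^ j) S) :
    ∃ C, ∀ j, |u j| * √(∑ i, x i ^ 2) ^ j ≤ C := by
  have hρ : 0 ≤ ∑ i, x i ^ 2 := Finset.sum_nonneg fun i _ => sq_nonneg _
  rcases hρ.eq_or_lt with h0 | hpos
  · refine ⟨|u 0|, fun j => ?_⟩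
    rw [← h0, Real.sqrt_zero]
    rcases j with _ | j <;> simp
  set r := √(∑ i, x i ^ 2) with hr
  have hr0 : 0 < r := Real.sqrt_pos.2 hpos
  have hr2 : r ^ 2 = ∑ i, x i ^ 2 := Real.sq_sqrt hρ
  have hy : bodyVector n x ≠ 0 := fun hy => by
    have h2 := bodyVector_sq n x
    rw [hy, sq, zero_mul] at h2
    exact smul_ne_zero (neg_ne_zero.2 hpos.ne') one_ne_zero h2.symm
  have hex : ∀ v : SuperClifford m n, v ≠ 0 → ∃ l : Module.Dual ℝ (SuperClifford m n), l v ≠ 0 :=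
    fun v hv => by
      by_contra! hl
      exact hv ((Module.forall_dual_apply_eq_zero_iff ℝ v).1 hl)
  obtain ⟨l₁, hl₁⟩ := hex 1 one_ne_zero
  obtain ⟨l₂, hl₂⟩ := hex _ hy
  obtain ⟨C₁, hC₁⟩ := h.exists_bound (l₁ ∘ₗ (body m n).toLinearMap)
  obtain ⟨C₂, hC₂⟩ := h.exists_bound (l₂ ∘ₗ (body m n).toLinearMap)
  refine ⟨max (C₁ / |l₁ 1|) (C₂ / |l₂ (bodyVector n x)| * r), fun j => ?_⟩
  have habs : ∀ s, |(-∑ j, x j ^ 2) ^ s| = r ^ (2 * s) := fun s => by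
    rw [abs_pow, abs_neg, abs_of_nonneg hρ, ← hr2, pow_mul]
  rcases Nat.even_or_odd' j with ⟨s, rfl | rfl⟩
  · refine le_max_of_le_left ((le_div_iff₀ (abs_pos.2 hl₁)).2 (le_trans (le_of_eq ?_)
      (hC₁ (2 * s))))
    simp [body_superVector, bodyVector_pow_even, abs_mul, habs, mul_assoc]
  · refine le_max_of_le_right ?_
    rw [pow_succ, ← mul_assoc]
    refine mul_le_mul_of_nonneg_right ((le_div_iff₀ (abs_pos.2 hl₂)).2 (le_trans (le_of_eq ?_)
      (hC₂ (2 * s + 1)))) hr0.le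
    simp [body_superVector, bodyVector_pow_odd, abs_mul, habs, mul_assoc]

/-- The coefficients of the even part of `∑ u_j y^j` as a power series in `ρ = -y²`. -/
noncomputable def evenCoeff (u : ℕ → ℝ) (s : ℕ) : ℝ := (-1) ^ s * u (2 * s)

/-- The coefficients of the odd part of `∑ u_j y^j`, divided by `y`, as a power series in
`ρ = -y²`. -/
noncomputable def oddCoeff (u : ℕ → ℝ) (s : ℕ) : ℝ := (-1) ^ s * u (2 * s + 1)

theorem evenCoeff_bound {u : ℕ → ℝ} {R C : ℝ} (h : ∀ j, |u j| * R ^ j ≤ C) (s : ℕ) :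
    |evenCoeff u s| * (R ^ 2) ^ s ≤ C := by
  simpa [evenCoeff, abs_mul, pow_mul] using h (2 * s)

theorem oddCoeff_bound {u : ℕ → ℝ} {R C : ℝ} (hR : 0 < R) (h : ∀ j, |u j| * R ^ j ≤ C) (s : ℕ) :
    |oddCoeff u s| * (R ^ 2) ^ s ≤ C / R := by
  rw [le_div_iff₀ hR, mul_assoc, ← pow_mul, ← pow_succ]
  simpa [oddCoeff, abs_mul] using h (2 * s + 1)

theorem hasSum_of_eq {f g : ℕ → ℝ} {a b : ℝ} (h : HasSum f a) (hf : ∀ j, g j = f j)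
    (hb : b = a) : HasSum g b := by
  rwa [hb, show g = f from funext hf]

theorem hasSum_body_pow {m n : ℕ} {u : ℕ → ℝ} {R C : ℝ} (hR : 0 < R)
    (hu : ∀ j, |u j| * R ^ j ≤ C) {x : Fin m → ℝ} (hx : ∑ i, x i ^ 2 < R ^ 2)
    (l : Module.Dual ℝ (SuperClifford m n)) :
    HasSum (fun j => u j * l (bodyVector n x ^ j))
      (l ((∑' s, evenCoeff u s * (∑ i, x i ^ 2) ^ s) • (1 : SuperClifford m n)
        + (∑' s, oddCoeff u s * (∑ i, x i ^ 2) ^ s) • bodyVector n x)) := by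
  have hx' : |∑ i, x i ^ 2| < R ^ 2 := by
    rwa [abs_of_nonneg (Finset.sum_nonneg fun i _ => sq_nonneg _)]
  rw [map_add, map_smul, map_smul, smul_eq_mul, smul_eq_mul]
  refine HasSum.even_add_odd ?_ ?_
  · refine hasSum_of_eq ((summable_of_bounded_mul_pow (evenCoeff_bound hu) hx').hasSum.mul_right
      (l 1)) (fun s => ?_) rfl
    rw [bodyVector_pow_even, map_smul, smul_eq_mul, evenCoeff, neg_pow]
    ring
  · refine hasSum_of_eq ((summable_of_bounded_mul_pow (oddCoeff_bound hR hu) hx').hasSum.mul_right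
      (l (bodyVector n x))) (fun s => ?_) rfl
    rw [bodyVector_pow_odd, map_smul, smul_eq_mul, oddCoeff, neg_pow]
    ring

theorem body_sum_eq {m n : ℕ} {u : ℕ → ℝ} {R C : ℝ} (hR : 0 < R)
    (hu : ∀ j, |u j| * R ^ j ≤ C) {x : Fin m → ℝ} (hx : ∑ i, x i ^ 2 < R ^ 2)
    {S : SuperVal m n} (h : SeriesConvergesTo (fun j => u j • superVector n x ^ j) S) :
    body m n S = (∑' s, evenCoeff u s * (∑ i, x i ^ 2) ^ s) • (1 : SuperClifford m n)
        + (∑' s, oddCoeff u s * (∑ i, x i ^ 2) ^ s) • bodyVector n x := by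
  refine h.map_eq (body m n).toLinearMap fun l => ?_
  convert hasSum_body_pow hR hu hx l using 2 with j
  simp [body_superVector]

theorem body_fermDirac_sum_eq {m n : ℕ} {u : ℕ → ℝ} {R C : ℝ} (hR : 0 < R)
    (hu : ∀ j, |u j| * R ^ j ≤ C) {x : Fin m → ℝ} (hx : ∑ i, x i ^ 2 < R ^ 2)
    {S : SuperVal m n} (h : SeriesConvergesTo (fun j => u j • superVector n x ^ j) S) :
    body m n (fermDirac S)
      = (-(2 * n) * ∑' s, oddCoeff u s * (∑ i, x i ^ 2) ^ s) • (1 : SuperClifford m n) := by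
  have hx' : |∑ i, x i ^ 2| < R ^ 2 := by
    rwa [abs_of_nonneg (Finset.sum_nonneg fun i _ => sq_nonneg _)]
  refine h.map_eq ((body m n).toLinearMap ∘ₗ fermDiracL m n) fun l => ?_
  have hL : ∀ j, l (((body m n).toLinearMap ∘ₗ fermDiracL m n) (u j • superVector n x ^ j))
      = u j * l (body m n (fermDirac (superVector n x ^ j))) := fun j => by
    rw [map_smul, map_smul]; rfl
  simp only [hL]
  rw [← zero_add (l _)]
  refine HasSum.even_add_odd ?_ ?_
  · simp only [body_fermDirac_superVector_pow_even, map_zero, mul_zero]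
    exact hasSum_zero
  · refine hasSum_of_eq (((summable_of_bounded_mul_pow (oddCoeff_bound hR hu)
      hx').hasSum.mul_left (-(2 * n : ℝ))).mul_right (l 1)) (fun s => ?_) ?_
    · rw [body_fermDirac_superVector_pow_odd, map_smul, smul_eq_mul, oddCoeff, neg_pow]
      ring
    · rw [map_smul, smul_eq_mul]

/-! ### The recursion for the coefficients, `m ≠ 0` -/

theorem hasBosDerivAt_bosDeriv {m n : ℕ} {F : Pt m → SuperVal m n} {Ω : Set (Pt m)}
    (hΩ : IsOpen Ω) (hF : IsSuperfunctionOn F Ω) {p : Pt m} (hp : p ∈ Ω) (v : Pt m) :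
    HasBosDerivAt F (bosDeriv F p v) p v := by
  obtain ⟨s, f, a, hf, hFa⟩ := hF
  rw [bosDeriv_eq hΩ hf hFa hp v]
  intro l
  have h1 : HasLineDerivAt ℝ (fun q => ∑ r, f r q * l (a r))
      (∑ r, (fderiv ℝ (f r) p v) * l (a r)) p v := by
    have h := HasFDerivAt.fun_sum (u := Finset.univ) fun r _ =>
      ((((hf r).contDiffAt (hΩ.mem_nhds hp)).differentiableAt (by simp)).hasFDerivAt).mul_const
        (l (a r))
    have h' := h.hasLineDerivAt v
    have hv : ∑ r, (l (a r) • fderiv ℝ (f r) p) v = ∑ r, (fderiv ℝ (f r) p v) * l (a r) :=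
      Finset.sum_congr rfl fun r _ => mul_comm (l (a r)) (fderiv ℝ (f r) p v)
    rwa [sum_apply, hv] at h'
  have h2 := h1.congr_of_eventuallyEq (f₁ := fun q => l (F q)) (by
    filter_upwards [hΩ.mem_nhds hp] with q hq
    simp [hFa q hq])
  simpa using h2

theorem bodyVector_add {m : ℕ} (n : ℕ) (x y : Fin m → ℝ) :
    bodyVector n (x + y) = bodyVector n x + bodyVector n y := by
  simp [bodyVector, add_smul, Finset.sum_add_distrib]

theorem bodyVector_smul {m : ℕ} (n : ℕ) (c : ℝ) (x : Fin m → ℝ) :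
    bodyVector n (c • x) = c • bodyVector n x := by
  simp [bodyVector, mul_smul, Finset.smul_sum]

theorem bodyVector_single {m : ℕ} (n : ℕ) (i : Fin m) :
    bodyVector n (Pi.single i 1) = cliffordGen m n (Sum.inl i) := by
  simp [bodyVector, Pi.single_apply]

theorem cliffordGen_inl_sq {m n : ℕ} (i : Fin m) :
    cliffordGen m n (Sum.inl i) * cliffordGen m n (Sum.inl i) = (-1 : ℝ) • 1 := by
  rw [← bodyVector_single, ← sq, bodyVector_sq]
  simp [Pi.single_apply]

theorem sum_smul_single_sq {m : ℕ} (i : Fin m) (z : ℝ) :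
    ∑ k, (z • (Pi.single i 1 : Fin m → ℝ)) k ^ 2 = z ^ 2 := by
  simp [Pi.single_apply]

/-- The bosonic derivatives of the body of `∑ u_j 𝐱^j` at a point of the `i₀`-th coordinate axis. -/
theorem body_bosDeriv_eq {m n : ℕ} {F : Pt m → SuperVal m n} {Ω : Set (Pt m)}
    (hΩ : IsOpen Ω) (hF : IsSuperfunctionOn F Ω) {u : ℕ → ℝ} {R C : ℝ} (hR : 0 < R)
    (hu : ∀ j, |u j| * R ^ j ≤ C) {t z : ℝ} (hz : |z| < R) (i₀ i : Fin m)
    (hs : ∀ x : Fin m → ℝ, ∑ i, x i ^ 2 < R ^ 2 → (t, x) ∈ Ω ∧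
      SeriesConvergesTo (fun j => u j • superVector n x ^ j) (F (t, x)))
    {E' O' : ℝ} (hE : HasDerivAt (fun ρ => ∑' s, evenCoeff u s * ρ ^ s) E' (z ^ 2))
    (hO : HasDerivAt (fun ρ => ∑' s, oddCoeff u s * ρ ^ s) O' (z ^ 2)) :
    body m n (bosDeriv F (t, z • Pi.single i₀ 1) (0, Pi.single i 1))
      = (if i = i₀ then (2 * z * E') • (1 : SuperClifford m n)
            + (2 * z ^ 2 * O') • cliffordGen m n (Sum.inl i₀) else 0)
        + (∑' s, oddCoeff u s * (z ^ 2) ^ s) • cliffordGen m n (Sum.inl i) := by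
  have hz2 : z ^ 2 < R ^ 2 := sq_lt_sq.2 (by rwa [abs_of_pos hR])
  rw [← sub_eq_zero, ← Module.forall_dual_apply_eq_zero_iff ℝ]
  intro l
  rw [map_sub, sub_eq_zero]
  have hp := (hs (z • Pi.single i₀ 1) (by rwa [sum_smul_single_sq])).1
  have h1 : HasDerivAt (fun μ : ℝ => l (body m n
      (F ((t, z • Pi.single i₀ 1) + μ • (0, Pi.single i 1))))) _ 0 :=
    hasBosDerivAt_bosDeriv hΩ hF hp (0, Pi.single i 1) (l ∘ₗ (body m n).toLinearMap)
  set ρ : ℝ → ℝ := fun μ => ∑ k,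
    (z • (Pi.single i₀ 1 : Fin m → ℝ) + μ • (Pi.single i 1 : Fin m → ℝ)) k ^ 2 with hρ
  have hρ0 : ρ 0 = z ^ 2 := by
    simp only [hρ, zero_smul, add_zero]
    exact sum_smul_single_sq i₀ z
  have hρ' : HasDerivAt ρ (if i = i₀ then 2 * z else 0) 0 := by
    have h : HasDerivAt ρ (∑ k, 2 * (z * (Pi.single i₀ 1 : Fin m → ℝ) k)
        * (Pi.single i 1 : Fin m → ℝ) k) 0 := by
      refine HasDerivAt.fun_sum fun k _ => ?_
      have h3 := (((hasDerivAt_id (0 : ℝ)).mul_const ((Pi.single i 1 : Fin m → ℝ) k)).const_add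
        (z * (Pi.single i₀ 1 : Fin m → ℝ) k)).fun_pow 2
      simpa using h3
    convert h using 1
    rw [Finset.sum_eq_single i (fun k _ hk => by simp [hk]) (by simp)]
    by_cases hi : i = i₀ <;> simp [hi]
  have hE2 : HasDerivAt (fun μ => ∑' s, evenCoeff u s * (ρ μ) ^ s)
      (E' * (if i = i₀ then 2 * z else 0)) 0 :=
    HasDerivAt.comp (h₂ := fun ρ => ∑' s, evenCoeff u s * ρ ^ s) 0 (by rwa [hρ0]) hρ'
  have hO2 : HasDerivAt (fun μ => ∑' s, oddCoeff u s * (ρ μ) ^ s)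
      (O' * (if i = i₀ then 2 * z else 0)) 0 :=
    HasDerivAt.comp (h₂ := fun ρ => ∑' s, oddCoeff u s * ρ ^ s) 0 (by rwa [hρ0]) hρ'
  have h4 := (hE2.mul_const (l 1)).add (hO2.mul
    (((hasDerivAt_id (0 : ℝ)).mul_const (l (cliffordGen m n (Sum.inl i)))).const_add
      (z * l (cliffordGen m n (Sum.inl i₀)))))
  have hev : (fun μ : ℝ => l (body m n (F ((t, z • Pi.single i₀ 1) + μ • (0, Pi.single i 1)))))
      =ᶠ[𝓝 0] fun μ => (∑' s, evenCoeff u s * (ρ μ) ^ s) * l 1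
        + (∑' s, oddCoeff u s * (ρ μ) ^ s)
          * (z * l (cliffordGen m n (Sum.inl i₀)) + μ * l (cliffordGen m n (Sum.inl i))) := by
    filter_upwards [hρ'.continuousAt.eventually_lt_const (by rwa [hρ0] : ρ 0 < R ^ 2)] with μ hμ
    rw [Prod.smul_mk, Prod.mk_add_mk, smul_zero, add_zero, body_sum_eq hR hu hμ (hs _ hμ).2,
      bodyVector_add, bodyVector_smul, bodyVector_smul, bodyVector_single, bodyVector_single]
    simp only [map_add, map_smul, smul_eq_mul]
    rfl
  refine (h1.unique (h4.congr_of_eventuallyEq hev)).trans ?_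
  simp only [hρ0]
  by_cases hi : i = i₀
  · simp [hi]; ring
  · simp [hi]

/-- Monogenicity, restricted to the body and to a coordinate axis, determines the
`x_0`-derivative. -/
theorem body_bosDeriv_zero_eq {m n : ℕ} {F : Pt m → SuperVal m n} {Ω : Set (Pt m)}
    (hΩ : IsOpen Ω) (hF : IsMonogenicOn F Ω) {u : ℕ → ℝ} {R C : ℝ} (hR : 0 < R)
    (hu : ∀ j, |u j| * R ^ j ≤ C) {t z : ℝ} (hz : |z| < R) (i₀ : Fin m)
    (hs : ∀ x : Fin m → ℝ, ∑ i, x i ^ 2 < R ^ 2 → (t, x) ∈ Ω ∧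
      SeriesConvergesTo (fun j => u j • superVector n x ^ j) (F (t, x)))
    {E' O' : ℝ} (hE : HasDerivAt (fun ρ => ∑' s, evenCoeff u s * ρ ^ s) E' (z ^ 2))
    (hO : HasDerivAt (fun ρ => ∑' s, oddCoeff u s * ρ ^ s) O' (z ^ 2)) :
    body m n (bosDeriv F (t, z • Pi.single i₀ 1) (1, 0))
      = (superDim m n * (∑' s, oddCoeff u s * (z ^ 2) ^ s) + 2 * z ^ 2 * O') •
          (1 : SuperClifford m n) - (2 * z * E') • cliffordGen m n (Sum.inl i₀) := by
  have hz2 : z ^ 2 < R ^ 2 := sq_lt_sq.2 (by rwa [abs_of_pos hR])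
  have hx : ∑ k, (z • (Pi.single i₀ 1 : Fin m → ℝ)) k ^ 2 < R ^ 2 := by rwa [sum_smul_single_sq]
  obtain ⟨hp, hconv⟩ := hs _ hx
  have h := congrArg (body m n) (hF.2 _ hp)
  rw [cauchyRiemann, superDirac, map_zero, map_sub, sub_eq_zero, map_sub,
    body_fermDirac_sum_eq hR hu hx hconv, sum_smul_single_sq, bosDirac, map_sum] at h
  rw [← h]
  simp only [map_mul, body_eBos, body_bosDeriv_eq hΩ hF.1 hR hu hz i₀ _ hs hE hO, mul_add,
    mul_smul_comm, cliffordGen_inl_sq, Finset.sum_add_distrib, mul_ite, mul_zero, mul_one,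
    Finset.sum_ite_eq', Finset.mem_univ, if_true, Finset.sum_const, Finset.card_fin,
    ← Nat.cast_smul_eq_nsmul ℝ, superDim]
  push_cast
  module

/-- The expansion along a coordinate axis of the `x_0`-derivative of a monogenic series. -/
theorem hasSum_body_bosDeriv_zero {m n : ℕ} {F : Pt m → SuperVal m n} {Ω : Set (Pt m)}
    (hΩ : IsOpen Ω) (hF : IsMonogenicOn F Ω) {u : ℕ → ℝ} {R C : ℝ} (hR : 0 < R)
    (hu : ∀ j, |u j| * R ^ j ≤ C) {t z : ℝ} (hz : |z| < R) (i₀ : Fin m)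
    (hs : ∀ x : Fin m → ℝ, ∑ i, x i ^ 2 < R ^ 2 → (t, x) ∈ Ω ∧
      SeriesConvergesTo (fun j => u j • superVector n x ^ j) (F (t, x)))
    (l : Module.Dual ℝ (SuperClifford m n)) :
    HasSum (fun j => (diracCoeff m n (j + 1) * u (j + 1)
        * l (cliffordGen m n (Sum.inl i₀) ^ j)) * z ^ j)
      (l (body m n (bosDeriv F (t, z • Pi.single i₀ 1) (1, 0)))) := by
  set g := cliffordGen m n (Sum.inl i₀) with hg
  have hz2' : |z ^ 2| < R ^ 2 := by
    rw [abs_of_nonneg (sq_nonneg z)]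
    exact sq_lt_sq.2 (by rwa [abs_of_pos hR])
  obtain ⟨E', hE, hE'⟩ := hasDerivAt_tsum_mul_pow (evenCoeff_bound hu) hz2'
  obtain ⟨O', hO, hO'⟩ := hasDerivAt_tsum_mul_pow (oddCoeff_bound hR hu) hz2'
  have hOs := (summable_of_bounded_mul_pow (oddCoeff_bound hR hu) hz2').hasSum
  rw [body_bosDeriv_zero_eq hΩ hF hR hu hz i₀ hs hE hO, sub_eq_add_neg,
    map_add, map_neg, map_smul, map_smul, smul_eq_mul, smul_eq_mul]
  have hgpow : ∀ s, g ^ (2 * s) = ((-1 : ℝ) ^ s) • 1 := fun s => by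
    rw [pow_mul, sq, hg, cliffordGen_inl_sq, smul_pow, one_pow]
  refine HasSum.even_add_odd ?_ ?_
  · refine hasSum_of_eq (((hOs.mul_left (superDim m n : ℝ)).add
      (hO'.mul_left (2 * z ^ 2))).mul_right (l 1)) (fun s => ?_) rfl
    have hsz : 2 * z ^ 2 * ((s : ℝ) * (z ^ 2) ^ (s - 1)) = 2 * (s : ℝ) * z ^ (2 * s) := by
      rcases s with _ | s
      · simp
      · rw [Nat.add_sub_cancel, pow_mul, pow_succ (z ^ 2) s]; ring
    rw [diracCoeff_odd, hgpow, map_smul, smul_eq_mul,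
      mul_left_comm (2 * z ^ 2) (oddCoeff _ s), hsz, oddCoeff, pow_mul z 2 s]
    ring
  · have hE2 : HasSum (fun s : ℕ => evenCoeff u (s + 1)
        * (((s + 1 : ℕ) : ℝ) * (z ^ 2) ^ s)) E' := by
      have h1 := (hasSum_nat_add_iff' 1).2 hE'
      simpa using h1
    refine hasSum_of_eq ((hE2.mul_left (-(2 * z))).mul_right (l g)) (fun s => ?_) (by ring)
    rw [show 2 * s + 1 + 1 = 2 * (s + 1) by ring, diracCoeff_even, pow_succ g, hgpow,
      smul_one_mul, map_smul, smul_eq_mul, evenCoeff, pow_succ z, pow_mul z 2 s]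
    push_cast
    ring

/-- Around a point of the `x_0`-axis, all the series converge on a common neighbourhood. -/
theorem exists_radius {m n : ℕ} (i₀ : Fin m) {f : ℕ → ℝ → ℝ} {Ω : Set (Pt m)} (hΩ : IsOpen Ω)
    {F : Pt m → SuperVal m n}
    (hF : ∀ p ∈ Ω, SeriesConvergesTo (fun j => f j p.1 • superVector n p.2 ^ j) (F p))
    {t₀ : ℝ} (ht₀ : (t₀, 0) ∈ Ω) :
    ∃ R > 0, ∀ᶠ t in 𝓝 t₀, (∃ C, ∀ j, |f j t| * R ^ j ≤ C) ∧
      ∀ x : Fin m → ℝ, ∑ i, x i ^ 2 < R ^ 2 → (t, x) ∈ Ω ∧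
        SeriesConvergesTo (fun j => f j t • superVector n x ^ j) (F (t, x)) := by
  obtain ⟨ε, hε, hball⟩ := Metric.isOpen_iff.1 hΩ _ ht₀
  have hmem : ∀ (t : ℝ) (x : Fin m → ℝ), |t - t₀| < ε → (∀ i, |x i| < ε) → (t, x) ∈ Ω := by
    intro t x ht hx
    refine hball ?_
    rw [Metric.mem_ball, Prod.dist_eq, max_lt_iff]
    refine ⟨ht, (dist_pi_lt_iff hε).2 fun i => ?_⟩
    simpa using hx i
  have hR : 0 < ε / 2 := by positivity
  have hRε : ε / 2 < ε := half_lt_self hε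
  refine ⟨ε / 2, hR, ?_⟩
  filter_upwards [Metric.ball_mem_nhds t₀ hε] with t ht
  refine ⟨?_, fun x hx => ?_⟩
  · have hp : (t, (ε / 2) • (Pi.single i₀ 1 : Fin m → ℝ)) ∈ Ω := hmem _ _ ht fun i => by
      by_cases hi : i = i₀
      · subst hi
        rw [Pi.smul_apply, Pi.single_eq_same, smul_eq_mul, mul_one, abs_of_pos hR]
        exact hRε
      · rw [Pi.smul_apply, Pi.single_eq_of_ne hi, smul_zero, abs_zero]
        exact hε
    have h := exists_bound_of_seriesConvergesTo (hF _ hp)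
    rwa [sum_smul_single_sq, Real.sqrt_sq hR.le] at h
  · have hp : (t, x) ∈ Ω := hmem t x ht fun i => by
      have hi : x i ^ 2 ≤ ∑ i, x i ^ 2 :=
        Finset.single_le_sum (f := fun i => x i ^ 2) (fun i _ => sq_nonneg (x i))
          (Finset.mem_univ i)
      exact (abs_lt_of_sq_lt_sq (hi.trans_lt hx) hR.le).trans hRε
    exact ⟨hp, hF (t, x) hp⟩

/-- The coefficients of a monogenic series `∑ 𝐱^j f_j(x_0)` satisfy `f_j' = c_{j+1} f_{j+1}`. -/
theorem hasDerivAt_coeff {m n : ℕ} (hm : m ≠ 0) {f : ℕ → ℝ → ℝ}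
    {Ω : Set (Pt m)} (hΩ : IsOpen Ω) {F : Pt m → SuperVal m n}
    (hF : ∀ p ∈ Ω, SeriesConvergesTo (fun j => f j p.1 • superVector n p.2 ^ j) (F p))
    (hmono : IsMonogenicOn F Ω) (j : ℕ) {t₀ : ℝ} (ht₀ : ((t₀, 0) : Pt m) ∈ Ω) :
    HasDerivAt (f j) (diracCoeff m n (j + 1) * f (j + 1) t₀) t₀ := by
  let i₀ : Fin m := ⟨0, Nat.pos_of_ne_zero hm⟩
  set g := cliffordGen m n (Sum.inl i₀) with hg
  obtain ⟨R, hR, hev⟩ := exists_radius i₀ hΩ hF ht₀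
  have hpow : ∀ (z : ℝ) (j : ℕ), bodyVector n (z • (Pi.single i₀ 1 : Fin m → ℝ)) ^ j
      = z ^ j • g ^ j := fun z j => by
    rw [bodyVector_smul, bodyVector_single, smul_pow]
  have hgg : g * -g = 1 := by rw [mul_neg, hg, cliffordGen_inl_sq, neg_one_smul, neg_neg]
  have hgunit : IsUnit g := ⟨⟨g, -g, hgg, by rw [neg_mul, ← mul_neg, hgg]⟩, rfl⟩
  -- a functional that detects the `j`-th power
  obtain ⟨l, hl⟩ : ∃ l : Module.Dual ℝ (SuperClifford m n), l (g ^ j) ≠ 0 := by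
    by_contra! hl
    exact (hgunit.pow j).ne_zero ((Module.forall_dual_apply_eq_zero_iff ℝ _).1 hl)
  let ι : ℝ × ℝ →L[ℝ] Pt m := (ContinuousLinearMap.fst ℝ ℝ ℝ).prod
    ((ContinuousLinearMap.snd ℝ ℝ ℝ).smulRight (Pi.single i₀ 1))
  have hι : ∀ t z, ι (t, z) = (t, z • Pi.single i₀ 1) := fun t z => rfl
  obtain ⟨h, hhdef⟩ : ∃ h : ℝ × ℝ → ℝ, ∀ q, h q = l (body m n (F (ι q))) := ⟨_, fun _ => rfl⟩
  have hU : IsOpen (ι ⁻¹' Ω) := hΩ.preimage ι.continuous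
  have hh : ContDiffOn ℝ ∞ h (ι ⁻¹' Ω) := by
    obtain ⟨s, φ, a, hφ, hFa⟩ := hmono.1
    have h1 : ContDiffOn ℝ ∞ (fun q => ∑ r, φ r (ι q) * l (body m n (a r))) (ι ⁻¹' Ω) :=
      ContDiffOn.sum fun r _ => ((hφ r).comp ι.contDiff.contDiffOn fun q hq => hq).mul
        contDiffOn_const
    refine h1.congr fun q hq => ?_
    rw [hhdef, hFa _ hq, map_sum, map_sum]
    simp only [map_smul, smul_eq_mul]
  have h0 : (t₀, (0 : ℝ)) ∈ ι ⁻¹' Ω := by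
    rw [mem_preimage, hι, zero_smul]
    exact ht₀
  have hzR : ∀ᶠ z in 𝓝 (0 : ℝ), |z| < R :=
    continuous_abs.continuousAt.eventually_lt_const (by simpa using hR)
  have hxz : ∀ z : ℝ, |z| < R → ∑ k, (z • (Pi.single i₀ 1 : Fin m → ℝ)) k ^ 2 < R ^ 2 := by
    intro z hz
    rw [sum_smul_single_sq]
    exact sq_lt_sq.2 (by rwa [abs_of_pos hR])
  have ha : ∀ᶠ t in 𝓝 t₀, ∀ᶠ z in 𝓝 (0 : ℝ),
      HasSum (fun j => (f j t * l (g ^ j)) * z ^ j) (h (t, z)) := by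
    filter_upwards [hev] with t ⟨⟨C, hC⟩, hs⟩
    filter_upwards [hzR] with z hz
    have h1 := hasSum_body_pow hR hC (hxz z hz) l
    rw [← body_sum_eq hR hC (hxz z hz) (hs _ (hxz z hz)).2] at h1
    refine hasSum_of_eq h1 (fun i => ?_) (by rw [hhdef, hι])
    rw [hpow, map_smul, smul_eq_mul]
    ring
  obtain ⟨⟨C, hC⟩, hs⟩ := hev.self_of_nhds
  have hb : ∀ᶠ z in 𝓝 (0 : ℝ),
      HasSum (fun j => (diracCoeff m n (j + 1) * f (j + 1) t₀ * l (g ^ j)) * z ^ j)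
        (dirDeriv (1, 0) h (t₀, z)) := by
    filter_upwards [hzR] with z hz
    refine hasSum_of_eq (hasSum_body_bosDeriv_zero hΩ hmono hR hC hz i₀ hs l) (fun _ => rfl) ?_
    have hp := (hs _ (hxz z hz)).1
    have h1 := hasDerivAt_fst_dirDeriv hU hh (t := t₀) (z := z) hp
    have h2 : HasDerivAt (fun μ : ℝ => l (body m n
        (F ((t₀, z • Pi.single i₀ 1) + μ • (1, 0))))) _ 0 :=
      hasBosDerivAt_bosDeriv hΩ hmono.1 hp (1, 0) (l ∘ₗ (body m n).toLinearMap)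
    have h3 : HasDerivAt (fun μ : ℝ => h (t₀ + μ, z)) (dirDeriv (1, 0) h (t₀, z)) 0 :=
      HasDerivAt.comp_const_add t₀ 0 (by rwa [add_zero])
    refine h3.unique (h2.congr_of_eventuallyEq (Eventually.of_forall fun μ => ?_))
    simp only [hhdef, hι]
    simp
  have hder := (hasDerivAt_coeff_of_contDiffOn hU hh h0 ha hb j).mul_const (l (g ^ j))⁻¹
  simpa [mul_assoc, hl] using hder

/-! ### The recursion for the coefficients, `m = 0` -/

theorem superVector_fin_zero (n : ℕ) (x : Fin 0 → ℝ) : superVector n x = fermVector 0 n := by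
  rw [superVector_eq, bosVector, Finset.univ_eq_empty, Finset.sum_empty, zero_add]

theorem sum_eq_of_fin_zero {n : ℕ} {u : ℕ → ℝ} {x : Fin 0 → ℝ} {S : SuperVal 0 n}
    (h : SeriesConvergesTo (fun j => u j • superVector n x ^ j) S) :
    S = ∑ j ∈ Finset.range (2 * n + 1), u j • fermVector 0 n ^ j := by
  refine h.map_eq LinearMap.id fun l => ?_
  simp only [superVector_fin_zero, LinearMap.id_apply, map_sum]
  refine hasSum_sum_of_ne_finset_zero fun j hj => ?_
  rw [← Nat.add_sub_cancel' (not_lt.1 (mt Finset.mem_range.2 hj)), pow_add,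
    fermVector_pow_eq_zero, zero_mul, smul_zero, map_zero]

theorem diracCoeff_eq_zero {m n k : ℕ} (h : superDim m n = -2 * (k : ℤ)) :
    diracCoeff m n (2 * k + 1) = 0 := by
  rw [diracCoeff_odd, h]
  push_cast
  ring

/-- If all variables are fermionic, then the series is a finite sum of the linearly independent
powers `Θ^j`, `j ≤ 2n`. -/
theorem hasDerivAt_coeff_fin_zero {n : ℕ} {f : ℕ → ℝ → ℝ} {Ω : Set (Pt 0)} (hΩ : IsOpen Ω)
    {F : Pt 0 → SuperVal 0 n}
    (hF : ∀ p ∈ Ω, SeriesConvergesTo (fun j => f j p.1 • superVector n p.2 ^ j) (F p))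
    (hmono : IsMonogenicOn F Ω) {j : ℕ} (hj : j ≤ 2 * n) {t₀ : ℝ} (ht₀ : ((t₀, 0) : Pt 0) ∈ Ω)
    (hf : ∀ j, DifferentiableAt ℝ (f j) t₀) :
    HasDerivAt (f j) (diracCoeff 0 n (j + 1) * f (j + 1) t₀) t₀ := by
  have hFq : ∀ q ∈ Ω, F q = ∑ j ∈ Finset.range (2 * n + 1), f j q.1 • fermVector 0 n ^ j :=
    fun q hq => sum_eq_of_fin_zero (hF q hq)
  have hbos : bosDeriv F (t₀, 0) (1, 0)
      = ∑ j ∈ Finset.range (2 * n + 1), deriv (f j) t₀ • fermVector 0 n ^ j := by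
    refine hasBosDerivAt_unique (hasBosDerivAt_bosDeriv hΩ hmono.1 ht₀ (1, 0)) fun l => ?_
    have h1 : HasDerivAt (fun μ : ℝ => ∑ j ∈ Finset.range (2 * n + 1),
        f j (t₀ + μ) * l (fermVector 0 n ^ j))
        (∑ j ∈ Finset.range (2 * n + 1), deriv (f j) t₀ * l (fermVector 0 n ^ j)) 0 := by
      refine HasDerivAt.fun_sum fun j _ => HasDerivAt.mul_const ?_ _
      exact HasDerivAt.comp_const_add t₀ 0 (by rw [add_zero]; exact (hf j).hasDerivAt)
    have hc : ContinuousAt (fun μ : ℝ => ((t₀, 0) : Pt 0) + μ • ((1, 0) : Pt 0)) 0 := by fun_prop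
    have h2 : ∀ᶠ μ : ℝ in 𝓝 0, ((t₀, 0) : Pt 0) + μ • ((1, 0) : Pt 0) ∈ Ω :=
      hc.preimage_mem_nhds (hΩ.mem_nhds (by rwa [zero_smul, add_zero]))
    have h3 := h1.congr_of_eventuallyEq
      (f₁ := fun μ : ℝ => l (F (((t₀, 0) : Pt 0) + μ • ((1, 0) : Pt 0)))) (by
        filter_upwards [h2] with μ hμ
        rw [hFq _ hμ, map_sum]
        simp)
    rw [map_sum]
    simp only [map_smul, smul_eq_mul]
    exact h3
  have hferm : fermDirac (F (t₀, 0)) = ∑ j ∈ Finset.range (2 * n + 1),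
      (diracCoeff 0 n (j + 1) * f (j + 1) t₀) • fermVector 0 n ^ j := by
    have hc : diracCoeff 0 n (2 * n + 1) = 0 := diracCoeff_eq_zero (by simp [superDim])
    rw [hFq _ ht₀, Finset.sum_range_succ', Finset.sum_range_succ _ (2 * n), hc, zero_mul,
      zero_smul, add_zero]
    change fermDiracL 0 n (_ + _) = _
    rw [map_add, map_sum, map_smul]
    have h1 : fermDiracL 0 n (fermVector 0 n ^ 0) = 0 := fermDirac_one 0 n
    rw [h1, smul_zero, add_zero]
    refine Finset.sum_congr rfl fun i _ => ?_
    rw [map_smul]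
    change _ • fermDirac _ = _
    rw [fermDirac_fermVector_pow, smul_smul, mul_comm]
  have h := hmono.2 _ ht₀
  rw [cauchyRiemann, superDirac, bosDirac, Finset.univ_eq_empty, Finset.sum_empty, sub_zero,
    hferm, hbos, ← Finset.sum_sub_distrib] at h
  simp only [← sub_smul] at h
  have h1 := fermVector_pow_coeff_eq_zero h j hj
  rw [sub_eq_zero.1 h1]
  exact (hf j).hasDerivAt

/-! ### Solving the recursion -/

/-- The factor `c_{a+1} c_{a+2} ⋯ c_{a+i}` between `f_{a+i}` and the `i`-th derivative of `f_a`. -/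
noncomputable def diracProd (m n a i : ℕ) : ℝ := ∏ r ∈ Finset.range i, diracCoeff m n (a + r + 1)

theorem iteratedDeriv_coeff {m n : ℕ} {Ω₁ : Set ℝ} (hΩ₁ : IsOpen Ω₁) {f : ℕ → ℝ → ℝ} {a i : ℕ}
    (h : ∀ j < a + i, ∀ t ∈ Ω₁, HasDerivAt (f j) (diracCoeff m n (j + 1) * f (j + 1) t) t)
    {t : ℝ} (ht : t ∈ Ω₁) :
    iteratedDeriv i (f a) t = diracProd m n a i * f (a + i) t := by
  induction i generalizing t with
  | zero => simp [diracProd]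
  | succ i ih =>
    have hev : iteratedDeriv i (f a) =ᶠ[𝓝 t] fun t => diracProd m n a i * f (a + i) t := by
      filter_upwards [hΩ₁.mem_nhds ht] with s hs
      exact ih (fun j hj => h j (by omega)) hs
    rw [iteratedDeriv_succ, hev.deriv_eq,
      ((h (a + i) (by omega) t ht).const_mul (diracProd m n a i)).deriv, diracProd, diracProd,
      Finset.prod_range_succ, mul_assoc]
    rfl

theorem diracProd_succ (m n a i : ℕ) :
    diracProd m n a (i + 1) = diracProd m n a i * diracCoeff m n (a + i + 1) :=
  Finset.prod_range_succ _ _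

theorem diracProd_zero (m n a : ℕ) : diracProd m n a 0 = 1 := Finset.prod_range_zero _

theorem diracProd_eq_zero {m n k : ℕ} (h : superDim m n = -2 * (k : ℤ)) :
    diracProd m n 0 (2 * k + 1) = 0 := by
  rw [diracProd_succ, zero_add, diracCoeff_eq_zero h, mul_zero]

theorem Gamma_superDim_ne_zero {m n : ℕ} (h : ¬ ∃ k : ℕ, superDim m n = -2 * (k : ℤ)) (s : ℕ) :
    Real.Gamma ((superDim m n : ℝ) / 2 + s) ≠ 0 := by
  refine Real.Gamma_ne_zero fun k hk => h ⟨k + s, ?_⟩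
  have : (superDim m n : ℝ) = ((-2 * ((k + s : ℕ) : ℤ) : ℤ) : ℝ) := by push_cast; linarith
  exact_mod_cast this

theorem superDim_half_add_ne_zero {m n : ℕ} (h : ¬ ∃ k : ℕ, superDim m n = -2 * (k : ℤ)) (s : ℕ) :
    (superDim m n : ℝ) / 2 + s ≠ 0 := fun h0 =>
  Gamma_superDim_ne_zero h s (by rw [h0, Real.Gamma_zero])

theorem Gamma_mul_diracProd {m n : ℕ} (h : ¬ ∃ k : ℕ, superDim m n = -2 * (k : ℤ)) (s : ℕ) :
    Real.Gamma ((superDim m n : ℝ) / 2) * diracProd m n 0 (2 * s)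
      = 4 ^ s * s.factorial * Real.Gamma ((superDim m n : ℝ) / 2 + s) := by
  induction s with
  | zero => simp [diracProd_zero]
  | succ s ih =>
    have hG : Real.Gamma ((superDim m n : ℝ) / 2 + (s + 1 : ℕ))
        = ((superDim m n : ℝ) / 2 + s) * Real.Gamma ((superDim m n : ℝ) / 2 + s) := by
      rw [← Real.Gamma_add_one (superDim_half_add_ne_zero h s)]
      push_cast
      ring_nf
    rw [show 2 * (s + 1) = 2 * s + 1 + 1 by ring, diracProd_succ, diracProd_succ, zero_add,
      zero_add, ← mul_assoc, ← mul_assoc, ih, diracCoeff_odd, hG,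
      show 2 * s + 1 + 1 = 2 * (s + 1) by ring, diracCoeff_even, Nat.factorial_succ]
    push_cast
    ring

theorem diracProd_mul_factorial_sub {m n k : ℕ} (h : superDim m n = -2 * (k : ℤ)) {s : ℕ}
    (hs : s ≤ k) :
    diracProd m n 0 (2 * s) * (k - s).factorial = (-1) ^ s * 4 ^ s * s.factorial * k.factorial := by
  induction s with
  | zero => simp [diracProd_zero]
  | succ s ih =>
    have ih' := ih (by omega)
    have hks : k - s = (k - (s + 1)) + 1 := by omega
    rw [hks, Nat.factorial_succ, ← hks] at ih'
    rw [show 2 * (s + 1) = 2 * s + 1 + 1 by ring, diracProd_succ, diracProd_succ, zero_add,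
      zero_add, diracCoeff_odd, show 2 * s + 1 + 1 = 2 * (s + 1) by ring, diracCoeff_even,
      Nat.factorial_succ, h]
    push_cast [Nat.cast_sub (by omega : s ≤ k)] at ih' ⊢
    linear_combination (-4 * ((s : ℝ) + 1)) * ih'

theorem diracProd_mul_factorial_add {m n k : ℕ} (h : superDim m n = -2 * (k : ℤ)) (s : ℕ) :
    diracProd m n (2 * k + 1) (2 * s) * k.factorial
      = 4 ^ s * s.factorial * (k + s).factorial := by
  induction s with
  | zero => simp [diracProd_zero]
  | succ s ih =>
    rw [show 2 * (s + 1) = 2 * s + 1 + 1 by ring, diracProd_succ, diracProd_succ,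
      show 2 * k + 1 + 2 * s + 1 = 2 * (k + s + 1) by ring, diracCoeff_even,
      show 2 * k + 1 + (2 * s + 1) + 1 = 2 * (k + s + 1) + 1 by ring, diracCoeff_odd, h,
      Nat.factorial_succ, ← add_assoc, Nat.factorial_succ]
    push_cast
    linear_combination (4 * ((k : ℝ) + s + 1) * (s + 1)) * ih

/-! ### Absolute convergence and the operator series -/

/-- Moving away from the origin along a coordinate axis gives a point with a larger norm. -/
theorem exists_radius_at {m n : ℕ} (hm : m ≠ 0) {f : ℕ → ℝ → ℝ} {Ω : Set (Pt m)} (hΩ : IsOpen Ω)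
    {F : Pt m → SuperVal m n}
    (hF : ∀ p ∈ Ω, SeriesConvergesTo (fun j => f j p.1 • superVector n p.2 ^ j) (F p))
    {p : Pt m} (hp : p ∈ Ω) :
    ∃ R > 0, ∃ C, (∀ j, |f j p.1| * R ^ j ≤ C) ∧ ∑ i, p.2 i ^ 2 < R ^ 2 := by
  let i₀ : Fin m := ⟨0, Nat.pos_of_ne_zero hm⟩
  have hc : ContinuousAt (fun μ : ℝ => (p.1, p.2 + μ • (Pi.single i₀ 1 : Fin m → ℝ))) 0 := by
    fun_prop
  have hev := hc.preimage_mem_nhds (hΩ.mem_nhds (by rw [zero_smul, add_zero]; exact hp))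
  obtain ⟨ε, hε, hball⟩ := Metric.mem_nhds_iff.1 hev
  have hsum : ∀ μ : ℝ, ∑ k, (p.2 + μ • (Pi.single i₀ 1 : Fin m → ℝ)) k ^ 2
      = ∑ k, p.2 k ^ 2 + (2 * μ * p.2 i₀ + μ ^ 2) := by
    intro μ
    have h1 : ∀ k, (p.2 + μ • (Pi.single i₀ 1 : Fin m → ℝ)) k ^ 2
        = p.2 k ^ 2 + if k = i₀ then 2 * μ * p.2 i₀ + μ ^ 2 else 0 := by
      intro k
      by_cases hk : k = i₀
      · subst hk; simp; ring
      · simp [hk]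
    rw [Finset.sum_congr rfl fun k _ => h1 k, Finset.sum_add_distrib]
    simp
  obtain ⟨μ, hμε, hμ⟩ : ∃ μ : ℝ, |μ| < ε ∧ 0 < 2 * μ * p.2 i₀ + μ ^ 2 := by
    rcases le_total 0 (p.2 i₀) with h | h
    · exact ⟨ε / 2, by rw [abs_of_pos (by positivity)]; linarith, by positivity⟩
    · refine ⟨-(ε / 2), by rw [abs_neg, abs_of_pos (by positivity)]; linarith, ?_⟩
      have : 0 ≤ ε * -(p.2 i₀) := mul_nonneg hε.le (neg_nonneg.2 h)
      nlinarith [sq_pos_of_pos hε]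
  have hq : (p.1, p.2 + μ • (Pi.single i₀ 1 : Fin m → ℝ)) ∈ Ω :=
    hball (by simpa using hμε)
  have h0 : 0 ≤ ∑ k, p.2 k ^ 2 := Finset.sum_nonneg fun k _ => sq_nonneg _
  have hlt : ∑ k, p.2 k ^ 2 < ∑ k, (p.2 + μ • (Pi.single i₀ 1 : Fin m → ℝ)) k ^ 2 := by
    rw [hsum]; linarith
  obtain ⟨C, hC⟩ := exists_bound_of_seriesConvergesTo (hF _ hq)
  refine ⟨_, Real.sqrt_pos.2 (h0.trans_lt hlt), C, hC, ?_⟩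
  rwa [Real.sq_sqrt (h0.trans hlt.le)]

/-- Splitting of an absolutely convergent series `∑ u_j 𝐱^j` into its even and odd part. -/
theorem exists_even_odd_sum {m n : ℕ} {u : ℕ → ℝ} {R C : ℝ} (hR : 0 < R)
    (hu : ∀ j, |u j| * R ^ j ≤ C) {x : Fin m → ℝ} (hx : ∑ i, x i ^ 2 < R ^ 2) :
    ∃ A B : SuperVal m n,
      SeriesConvergesAbsTo (fun s => evenCoeff u s • superNormSq n x ^ s) A ∧
      SeriesConvergesAbsTo (fun s => oddCoeff u s • superNormSq n x ^ s) B ∧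
      SeriesConvergesAbsTo (fun j => u j • superVector n x ^ j) (A + superVector n x * B) := by
  have h0 : 0 ≤ ∑ i, x i ^ 2 := Finset.sum_nonneg fun i _ => sq_nonneg _
  have hnil : (-fermSq m n) ^ (n + 1) = 0 := by rw [neg_pow, fermSq_pow_succ, mul_zero]
  obtain ⟨A, hA⟩ := exists_hasSum_smul_pow_of_nilpotent hnil (evenCoeff_bound hu) h0 hx
  obtain ⟨B, hB⟩ := exists_hasSum_smul_pow_of_nilpotent hnil (oddCoeff_bound hR hu) h0 hx
  rw [← superNormSq_eq] at hA hB
  refine ⟨A, B, hA, hB, fun l => ?_⟩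
  rw [map_add]
  refine HasSum.even_add_odd ?_ ?_
  · refine hasSum_of_eq (hA l) (fun s => ?_) rfl
    beta_reduce
    rw [superVector_pow_two_mul, smul_smul, evenCoeff, mul_comm]
  · refine hasSum_of_eq (hB (l ∘ₗ LinearMap.mulLeft ℝ (superVector n x))) (fun s => ?_) rfl
    beta_reduce
    rw [LinearMap.comp_apply, LinearMap.mulLeft_apply, mul_smul_comm, pow_succ',
      superVector_pow_two_mul, mul_smul_comm, smul_smul, oddCoeff, mul_comm]

/-- The sum `∑ u_j 𝐱^j`, split into a polynomial of degree less than `a` in `𝐱` and the even and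
the odd part of the remainder. -/
theorem sum_eq_polynomial_add {m n : ℕ} {u : ℕ → ℝ} {R C : ℝ} (hR : 0 < R)
    (hu : ∀ j, |u j| * R ^ j ≤ C) {x : Fin m → ℝ} (hx : ∑ i, x i ^ 2 < R ^ 2)
    {S : SuperVal m n} (h : SeriesConvergesTo (fun j => u j • superVector n x ^ j) S) (a : ℕ) :
    ∃ A B : SuperVal m n,
      SeriesConvergesAbsTo (fun s => evenCoeff (fun j => u (a + j)) s • superNormSq n x ^ s) A ∧
      SeriesConvergesAbsTo (fun s => oddCoeff (fun j => u (a + j)) s • superNormSq n x ^ s) B ∧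
      S = ∑ j ∈ Finset.range a, u j • superVector n x ^ j
        + superVector n x ^ a * (A + superVector n x * B) := by
  have hu' : ∀ j, |u (a + j)| * R ^ j ≤ C / R ^ a := fun j => by
    rw [le_div_iff₀ (by positivity), mul_assoc, ← pow_add, add_comm j]
    exact hu _
  obtain ⟨A, B, hA, hB, hAB⟩ := exists_even_odd_sum (n := n) hR hu' hx
  refine ⟨A, B, hA, hB, h.map_eq LinearMap.id fun l => ?_⟩
  simp only [LinearMap.id_apply]
  rw [map_add, map_sum, add_comm, ← hasSum_nat_add_iff a]
  refine hasSum_of_eq (hAB (l ∘ₗ LinearMap.mulLeft ℝ (superVector n x ^ a))) (fun j => ?_) rfl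
  rw [LinearMap.comp_apply, LinearMap.mulLeft_apply, mul_smul_comm, ← pow_add, add_comm j]

theorem SeriesConvergesAbsTo.smul_of_eq {m n : ℕ} {N A : SuperVal m n} {a b : ℕ → ℝ}
    (h : SeriesConvergesAbsTo (fun s => a s • N ^ s) A) (c : ℝ) (hb : ∀ s, b s = c * a s) :
    SeriesConvergesAbsTo (fun s => b s • N ^ s) (c • A) := by
  intro l
  rw [map_smul, smul_eq_mul]
  refine hasSum_of_eq ((h l).mul_left c) (fun s => ?_) rfl
  beta_reduce
  rw [hb, mul_smul, map_smul, smul_eq_mul]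

theorem hasOpValue_of_besselJ {m n : ℕ} (ν : ℝ) {h : ℝ → ℝ}
    (hh : ∀ z, 0 < z → h z = (z / 2) ^ (-ν) * besselJ ν z) {N : SuperVal m n} {g : ℝ → ℝ} {t : ℝ}
    {A : SuperVal m n}
    (hA : SeriesConvergesAbsTo (fun j => ((-1) ^ j / (4 ^ j * j.factorial
      * Real.Gamma (ν + j + 1)) * iteratedDeriv (2 * j) g t) • N ^ j) A) :
    HasOpValue h N g t A :=
  ⟨_, fun z hz => by rw [hh z hz]; exact hasSum_besselJ ν hz, hA⟩

theorem polyOp_appellP {m n : ℕ} (k : ℕ) (N : SuperVal m n) (g : ℝ → ℝ) (t : ℝ) :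
    polyOp (appellP (k : ℤ)) N g t = ∑ s ∈ Finset.range (k + 1),
      (((k - s).factorial : ℝ) / (s.factorial : ℝ) * iteratedDeriv (2 * s) g t) • N ^ s := by
  have hP : appellP (k : ℤ) = ∑ j ∈ Finset.range (k + 1),
      Polynomial.monomial j (((k - j).factorial : ℝ) / (j.factorial : ℝ)) := rfl
  have hdeg : (appellP (k : ℤ)).natDegree < k + 1 := by
    rw [hP]
    refine Nat.lt_succ_of_le (Polynomial.natDegree_sum_le_of_forall_le _ _ fun j hj => ?_)
    exact (Polynomial.natDegree_monomial_le _).trans (Nat.lt_succ_iff.1 (Finset.mem_range.1 hj))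
  rw [polyOp, Polynomial.sum_over_range' _ (fun j => by simp) _ hdeg]
  refine Finset.sum_congr rfl fun s hs => ?_
  rw [hP, Polynomial.finsetSum_coeff, Finset.sum_eq_single s]
  · rw [Polynomial.coeff_monomial_same]
  · intro j _ hj
    rw [Polynomial.coeff_monomial_of_ne _ hj.symm]
  · exact fun h => absurd hs h

theorem polyOp_appellP_sub_one {m n : ℕ} (k : ℕ) (N : SuperVal m n) (g : ℝ → ℝ) (t : ℝ) :
    polyOp (appellP ((k : ℤ) - 1)) N g t = ∑ s ∈ Finset.range k,
      (((k - 1 - s).factorial : ℝ) / (s.factorial : ℝ) * iteratedDeriv (2 * s) g t) • N ^ s := by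
  rcases k with _ | k
  · have h : appellP (((0 : ℕ) : ℤ) - 1) = 0 := rfl
    rw [h, polyOp, Polynomial.sum_zero_index, Finset.sum_range_zero]
  · rw [show ((k + 1 : ℕ) : ℤ) - 1 = (k : ℤ) by push_cast; ring, polyOp_appellP,
      Nat.add_sub_cancel]

theorem sum_range_two_mul_succ {A : Type*} [AddCommMonoid A] (v : ℕ → A) (k : ℕ) :
    ∑ j ∈ Finset.range (2 * k + 1), v j
      = ∑ s ∈ Finset.range (k + 1), v (2 * s) + ∑ s ∈ Finset.range k, v (2 * s + 1) := by
  induction k with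
  | zero => simp
  | succ k ih =>
    rw [show 2 * (k + 1) + 1 = 2 * k + 1 + 1 + 1 by ring, Finset.sum_range_succ,
      Finset.sum_range_succ, ih, Finset.sum_range_succ _ (k + 1), Finset.sum_range_succ _ k,
      show 2 * k + 1 + 1 = 2 * (k + 1) by ring, Finset.sum_range_succ (fun s => v (2 * s + 1)) k]
    abel

/-- For `M = -2k` the terms of degree at most `2k` form the Appell polynomial part. -/
theorem sum_range_eq_appell {m n k : ℕ} (hk : superDim m n = -2 * (k : ℤ)) {Ω₁ : Set ℝ}
    (hΩ₁ : IsOpen Ω₁) {f : ℕ → ℝ → ℝ}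
    (h : ∀ j < 2 * k + 1, ∀ t ∈ Ω₁, HasDerivAt (f j) (diracCoeff m n (j + 1) * f (j + 1) t) t)
    {t : ℝ} (ht : t ∈ Ω₁) (x : Fin m → ℝ) :
    ∑ j ∈ Finset.range (2 * k + 1), f j t • superVector n x ^ j
      = (1 / (k.factorial : ℝ)) •
          (polyOp (appellP (k : ℤ)) ((1 / 4 : ℝ) • superNormSq n x) (f 0) t
            - (1 / 2 : ℝ) • (superVector n x *
              polyOp (appellP ((k : ℤ) - 1)) ((1 / 4 : ℝ) • superNormSq n x)
                (deriv (f 0)) t)) := by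
  have hfac : ∀ s : ℕ, (s.factorial : ℝ) ≠ 0 := fun s => by positivity
  rw [sum_range_two_mul_succ, polyOp_appellP, polyOp_appellP_sub_one, sub_eq_add_neg, smul_add,
    Finset.mul_sum, ← smul_neg, Finset.smul_sum, ← Finset.sum_neg_distrib, Finset.smul_sum,
    Finset.smul_sum]
  congr 1
  · refine Finset.sum_congr rfl fun s hs => ?_
    have hs' : s ≤ k := Nat.lt_succ_iff.1 (Finset.mem_range.1 hs)
    have hd := iteratedDeriv_coeff (a := 0) (i := 2 * s) hΩ₁
      (fun j hj => h j (by omega)) ht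
    have hP := diracProd_mul_factorial_sub hk hs'
    rw [hd, zero_add, superVector_pow_two_mul, smul_pow, smul_smul, smul_smul, smul_smul]
    congr 1
    rw [one_div_pow]
    have h1 := hfac s
    have h2 := hfac k
    field_simp
    linear_combination (-(f (2 * s) t)) * hP
  · refine Finset.sum_congr rfl fun s hs => ?_
    have hs' : s < k := Finset.mem_range.1 hs
    have hd := iteratedDeriv_coeff (a := 0) (i := 2 * s + 1) hΩ₁
      (fun j hj => h j (by omega)) ht
    have hP := diracProd_mul_factorial_sub hk hs'.le
    have hks : k - s = (k - 1 - s) + 1 := by omega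
    rw [hks, Nat.factorial_succ, ← hks] at hP
    rw [← iteratedDeriv_succ', hd, zero_add, pow_succ', superVector_pow_two_mul, smul_pow,
      diracProd_succ, zero_add, diracCoeff_odd, hk]
    simp only [mul_smul_comm, smul_smul, ← neg_smul]
    congr 1
    rw [one_div_pow]
    have h1 := hfac s
    have h2 := hfac k
    push_cast [Nat.cast_sub hs'.le] at hP ⊢
    field_simp
    linear_combination (-(f (2 * s + 1) t)) * hP

/-! ### The expansions -/

theorem rpow_mul_half_mul (a b : ℝ) {z : ℝ} (hz : 0 < z) :
    (z / 2) ^ a * (z / 2 * b) = (z / 2) ^ (a + 1) * b := by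
  rw [Real.rpow_add_one (by positivity)]
  ring

/-- The case `M ∉ -2ℕ`: all coefficients `c_j` are nonzero, so that `f_0` determines the series. -/
theorem expansion_of_superDim_ne {m n : ℕ} (hM : ¬ ∃ k : ℕ, superDim m n = -2 * (k : ℤ))
    {Ω₁ : Set ℝ} (hΩ₁ : IsOpen Ω₁) {f : ℕ → ℝ → ℝ}
    (h : ∀ j, ∀ t ∈ Ω₁, HasDerivAt (f j) (diracCoeff m n (j + 1) * f (j + 1) t) t)
    {t : ℝ} (ht : t ∈ Ω₁) {R C : ℝ} (hR : 0 < R) (hC : ∀ j, |f j t| * R ^ j ≤ C)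
    {x : Fin m → ℝ} (hx : ∑ i, x i ^ 2 < R ^ 2) {S : SuperVal m n}
    (hS : SeriesConvergesTo (fun j => f j t • superVector n x ^ j) S) :
    ∃ A B : SuperVal m n,
      HasOpValue (fun z => (z / 2) ^ (-((superDim m n : ℝ) / 2)) *
          (z / 2 * besselJ ((superDim m n : ℝ) / 2 - 1) z)) (superNormSq n x) (f 0) t A ∧
      HasOpValue (fun z => (z / 2) ^ (-((superDim m n : ℝ) / 2)) *
          besselJ ((superDim m n : ℝ) / 2) z) (superNormSq n x) (deriv (f 0)) t B ∧
      S = Real.Gamma ((superDim m n : ℝ) / 2) • (A + (1 / 2 : ℝ) • (superVector n x * B)) := by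
  obtain ⟨A, B, hA, hB, hAB⟩ := sum_eq_polynomial_add hR hC hx hS 0
  have hiter : ∀ i, iteratedDeriv i (f 0) t = diracProd m n 0 i * f (0 + i) t := fun i =>
    iteratedDeriv_coeff hΩ₁ (fun j _ => h j) ht
  have hGs := Gamma_superDim_ne_zero hM
  have hP := Gamma_mul_diracProd hM
  set ν := (superDim m n : ℝ) / 2 with hν
  have hG : Real.Gamma ν ≠ 0 := by simpa using hGs 0
  refine ⟨(Real.Gamma ν)⁻¹ • A, (2 * (Real.Gamma ν)⁻¹) • B,
    hasOpValue_of_besselJ (ν - 1) (fun z hz => ?_) (hA.smul_of_eq _ fun s => ?_),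
    hasOpValue_of_besselJ ν (fun z _ => rfl) (hB.smul_of_eq _ fun s => ?_), ?_⟩
  · rw [rpow_mul_half_mul _ _ hz, show -ν + 1 = -(ν - 1) by ring]
  · have h1 : (s.factorial : ℝ) ≠ 0 := by positivity
    have h2 := hGs s
    rw [hiter, evenCoeff, show ν - 1 + s + 1 = ν + s by ring]
    field_simp
    linear_combination (f (0 + 2 * s) t) * hP s
  · have h1 : (s.factorial : ℝ) ≠ 0 := by positivity
    have h2 := hGs s
    have h3 : ν + s ≠ 0 := superDim_half_add_ne_zero hM s
    have hM2 : (superDim m n : ℝ) = 2 * ν := by rw [hν]; ring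
    rw [← iteratedDeriv_succ', hiter, oddCoeff, Real.Gamma_add_one h3, diracProd_succ, zero_add,
      zero_add, diracCoeff_odd, hM2]
    field_simp
    linear_combination (f (2 * s + 1) t) * hP s
  · rw [hAB, Finset.sum_range_zero, zero_add, pow_zero, one_mul, mul_smul_comm, smul_add,
      smul_smul, smul_smul, smul_smul, mul_inv_cancel₀ hG, one_smul]
    congr 1
    rw [show Real.Gamma ν * (1 / 2) * (2 * (Real.Gamma ν)⁻¹) = 1 by field_simp, one_smul]

/-- The case `M = -2k`, `m ≠ 0`: since `c_{2k+1} = 0`, the coefficient `f_{2k+1}` is a second free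
datum, and it determines the terms of degree larger than `2k`. -/
theorem expansion_of_superDim_eq {m n k : ℕ} (hk : superDim m n = -2 * (k : ℤ))
    {Ω₁ : Set ℝ} (hΩ₁ : IsOpen Ω₁) {f : ℕ → ℝ → ℝ}
    (h : ∀ j, ∀ t ∈ Ω₁, HasDerivAt (f j) (diracCoeff m n (j + 1) * f (j + 1) t) t)
    {t : ℝ} (ht : t ∈ Ω₁) {R C : ℝ} (hR : 0 < R) (hC : ∀ j, |f j t| * R ^ j ≤ C)
    {x : Fin m → ℝ} (hx : ∑ i, x i ^ 2 < R ^ 2) {S : SuperVal m n}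
    (hS : SeriesConvergesTo (fun j => f j t • superVector n x ^ j) S) :
    ∃ A B : SuperVal m n,
      HasOpValue (fun z => (z / 2) ^ (-(k : ℝ) - 1) * (z / 2 * besselJ (k : ℝ) z))
        (superNormSq n x) (f (2 * k + 1)) t A ∧
      HasOpValue (fun z => (z / 2) ^ (-(k : ℝ) - 1) * besselJ ((k : ℝ) + 1) z)
        (superNormSq n x) (deriv (f (2 * k + 1))) t B ∧
      S = ∑ j ∈ Finset.range (2 * k + 1), f j t • superVector n x ^ j
        + (k.factorial : ℝ) • (superVector n x ^ (2 * k + 1) *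
            (A + (1 / 2 : ℝ) • (superVector n x * B))) := by
  obtain ⟨A, B, hA, hB, hAB⟩ := sum_eq_polynomial_add hR hC hx hS (2 * k + 1)
  have hiter : ∀ i, iteratedDeriv i (f (2 * k + 1)) t
      = diracProd m n (2 * k + 1) i * f (2 * k + 1 + i) t := fun i =>
    iteratedDeriv_coeff hΩ₁ (fun j _ => h j) ht
  have hP := diracProd_mul_factorial_add hk
  have hG : (k.factorial : ℝ) ≠ 0 := by positivity
  refine ⟨(k.factorial : ℝ)⁻¹ • A, (2 * (k.factorial : ℝ)⁻¹) • B,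
    hasOpValue_of_besselJ (k : ℝ) (fun z hz => ?_) (hA.smul_of_eq _ fun s => ?_),
    hasOpValue_of_besselJ ((k : ℝ) + 1) (fun z _ => ?_) (hB.smul_of_eq _ fun s => ?_), ?_⟩
  · rw [rpow_mul_half_mul _ _ hz, sub_add_cancel]
  · have h1 : (s.factorial : ℝ) ≠ 0 := by positivity
    have h2 : ((k + s).factorial : ℝ) ≠ 0 := by positivity
    rw [hiter, evenCoeff, ← Nat.cast_add, Real.Gamma_nat_eq_factorial]
    field_simp
    linear_combination (f (2 * k + 1 + 2 * s) t) * hP s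
  · rw [neg_add']
  · have h1 : (s.factorial : ℝ) ≠ 0 := by positivity
    have h2 : ((k + s).factorial : ℝ) ≠ 0 := by positivity
    have h3 : ((k : ℝ) + s + 1) ≠ 0 := by positivity
    rw [← iteratedDeriv_succ', hiter, oddCoeff,
      show (k : ℝ) + 1 + s + 1 = ((k + s + 1 : ℕ) : ℝ) + 1 by push_cast; ring,
      Real.Gamma_nat_eq_factorial, diracProd_succ,
      show 2 * k + 1 + 2 * s + 1 = 2 * (k + s + 1) by ring, diracCoeff_even, Nat.factorial_succ,
      show 2 * k + 1 + (2 * s + 1) = 2 * (k + s + 1) by ring]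
    push_cast
    field_simp
    linear_combination (f (2 * (k + s + 1)) t) * hP s
  · rw [hAB]
    congr 1
    rw [mul_smul_comm, smul_smul, ← mul_smul_comm, smul_add, smul_smul, smul_smul,
      mul_inv_cancel₀ hG, one_smul]
    congr 2
    rw [show (k.factorial : ℝ) * (1 / 2 * (2 * (k.factorial : ℝ)⁻¹)) = 1 by field_simp, one_smul]

end SuperCK

theorem mainTheorem4 (m n : ℕ) (Ω₁ : Set ℝ) (hΩ₁ : IsOpen Ω₁)
    (f : ℕ → ℝ → ℝ) (hf : ∀ j, AnalyticOnNhd ℝ (f j) Ω₁)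
    (Ω : Set (SuperCK.Pt m)) (hΩ : IsOpen Ω)
    (hΩ₁Ω : ∀ t ∈ Ω₁, ((t, 0) : SuperCK.Pt m) ∈ Ω) (hΩΩ₁ : ∀ p ∈ Ω, p.1 ∈ Ω₁)
    (F : SuperCK.Pt m → SuperCK.SuperVal m n)
    (hF : ∀ p ∈ Ω, SuperCK.SeriesConvergesTo
      (fun j => f j p.1 • SuperCK.superVector n p.2 ^ j) (F p))
    (hmono : SuperCK.IsMonogenicOn F Ω) :
    -- case i)
    ((¬ ∃ k : ℕ, SuperCK.superDim m n = -2 * (k : ℤ)) →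
      ∀ p ∈ Ω, ∃ A B : SuperCK.SuperVal m n,
        SuperCK.HasOpValue (fun z => (z / 2) ^ (-((SuperCK.superDim m n : ℝ) / 2)) *
            (z / 2 * SuperCK.besselJ ((SuperCK.superDim m n : ℝ) / 2 - 1) z))
          (SuperCK.superNormSq n p.2) (f 0) p.1 A ∧
        SuperCK.HasOpValue (fun z => (z / 2) ^ (-((SuperCK.superDim m n : ℝ) / 2)) *
            SuperCK.besselJ ((SuperCK.superDim m n : ℝ) / 2) z)
          (SuperCK.superNormSq n p.2) (deriv (f 0)) p.1 B ∧
        F p = Real.Gamma ((SuperCK.superDim m n : ℝ) / 2) •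
          (A + (1 / 2 : ℝ) • (SuperCK.superVector n p.2 * B))) ∧
    -- case ii)
    (∀ k : ℕ, SuperCK.superDim m n = -2 * (k : ℤ) → m ≠ 0 →
      (∀ t ∈ Ω₁, iteratedDeriv (2 * k + 1) (f 0) t = 0) ∧
      ∀ p ∈ Ω, ∃ A B : SuperCK.SuperVal m n,
        SuperCK.HasOpValue (fun z => (z / 2) ^ (-(k : ℝ) - 1) *
            (z / 2 * SuperCK.besselJ (k : ℝ) z))
          (SuperCK.superNormSq n p.2) (f (2 * k + 1)) p.1 A ∧
        SuperCK.HasOpValue (fun z => (z / 2) ^ (-(k : ℝ) - 1) * SuperCK.besselJ ((k : ℝ) + 1) z)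
          (SuperCK.superNormSq n p.2) (deriv (f (2 * k + 1))) p.1 B ∧
        F p = (1 / (k.factorial : ℝ)) •
            (SuperCK.polyOp (SuperCK.appellP (k : ℤ))
                ((1 / 4 : ℝ) • SuperCK.superNormSq n p.2) (f 0) p.1
              - (1 / 2 : ℝ) • (SuperCK.superVector n p.2 *
                SuperCK.polyOp (SuperCK.appellP ((k : ℤ) - 1))
                  ((1 / 4 : ℝ) • SuperCK.superNormSq n p.2) (deriv (f 0)) p.1))
          + (k.factorial : ℝ) • (SuperCK.superVector n p.2 ^ (2 * k + 1) *
              (A + (1 / 2 : ℝ) • (SuperCK.superVector n p.2 * B)))) ∧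
    -- case iii)
    (m = 0 →
      (∀ t ∈ Ω₁, iteratedDeriv (2 * n + 1) (f 0) t = 0) ∧
      ∀ p ∈ Ω,
        F p = (1 / (n.factorial : ℝ)) •
            (SuperCK.polyOp (SuperCK.appellP (n : ℤ))
                ((1 / 4 : ℝ) • SuperCK.superNormSq n p.2) (f 0) p.1
              - (1 / 2 : ℝ) • (SuperCK.superVector n p.2 *
                SuperCK.polyOp (SuperCK.appellP ((n : ℤ) - 1))
                  ((1 / 4 : ℝ) • SuperCK.superNormSq n p.2) (deriv (f 0)) p.1))) := by
  have hrec : m ≠ 0 → ∀ j, ∀ t ∈ Ω₁,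
      HasDerivAt (f j) (SuperCK.diracCoeff m n (j + 1) * f (j + 1) t) t :=
    fun hm j t ht => SuperCK.hasDerivAt_coeff hm hΩ hF hmono j (hΩ₁Ω t ht)
  refine ⟨fun hM p hp => ?_, fun k hk hm => ⟨fun t ht => ?_, fun p hp => ?_⟩, fun hm => ?_⟩
  · have hm : m ≠ 0 := fun hm => hM ⟨n, by simp [SuperCK.superDim, hm]⟩
    obtain ⟨R, hR, C, hC, hx⟩ := SuperCK.exists_radius_at hm hΩ hF hp
    exact SuperCK.expansion_of_superDim_ne hM hΩ₁ (hrec hm) (hΩΩ₁ p hp) hR hC hx (hF p hp)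
  · rw [SuperCK.iteratedDeriv_coeff hΩ₁ (fun j _ => hrec hm j) ht, SuperCK.diracProd_eq_zero hk,
      zero_mul]
  · obtain ⟨R, hR, C, hC, hx⟩ := SuperCK.exists_radius_at hm hΩ hF hp
    rw [← SuperCK.sum_range_eq_appell hk hΩ₁ (fun j _ => hrec hm j) (hΩΩ₁ p hp)]
    exact SuperCK.expansion_of_superDim_eq hk hΩ₁ (hrec hm) (hΩΩ₁ p hp) hR hC hx (hF p hp)
  · subst hm
    have hn : SuperCK.superDim 0 n = -2 * (n : ℤ) := by simp [SuperCK.superDim]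
    have hrec₀ : ∀ j < 2 * n + 1, ∀ t ∈ Ω₁,
        HasDerivAt (f j) (SuperCK.diracCoeff 0 n (j + 1) * f (j + 1) t) t := fun j hj t ht =>
      SuperCK.hasDerivAt_coeff_fin_zero hΩ hF hmono (Nat.lt_succ_iff.1 hj) (hΩ₁Ω t ht)
        fun i => (hf i t ht).differentiableAt
    refine ⟨fun t ht => ?_, fun p hp => ?_⟩
    · rw [SuperCK.iteratedDeriv_coeff hΩ₁ (fun j hj => hrec₀ j (by omega)) ht,
        SuperCK.diracProd_eq_zero hn, zero_mul]
    · rw [← SuperCK.sum_range_eq_appell hn hΩ₁ hrec₀ (hΩΩ₁ p hp), SuperCK.superVector_fin_zero]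
      exact SuperCK.sum_eq_of_fin_zero (hF p hp)
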